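/- Let $\mathbb D$ be the open unit disc and $\mathbb T$ the unit circle, let $C_\varphi f=f\circ\varphi$ on the Hardy space $H^2(\mathbb D)$, and let $a_n(T)=\inf\{\|T-R\| : \operatorname{rank}R<n\}$ be the $n$-th approximation number of $T$. For $z,w$ let $\rho(z,w)=|z-w|/|1-\bar z w|$ (with the value $0$ if $z=w$ and $|z|=1$). A holomorphic self-map of $\mathbb D$ is extended to the points $z\in\mathbb T$ at which its radial limit exists (almost all of them) by that limit; suprema over subsets of $\mathbb T$ are taken over the points at which the functions involved are so defined, and $\sup\varnothing=0$. A Blaschke product of degree $d$ is a function $B(z)=c\prod_{j=1}^{d}\frac{z-a_j}{1-\overline{a_j}z}$ with $|c|=1$ and $a_1,\dots,a_d\in\mathbb D$. There is an absolute constant $C>0$ such that the following holds for all $r\in(0,1)$, all integers $n\ge1$, all Blaschke products $B$ of degree $n-1$ and all holomorphic self-maps $\varphi,\psi$ of $\mathbb D$. Put $w(z)=\rho(\varphi(z),\psi(z))$. Then $$a_n(C_\varphi-C_\psi)\le C\Big(\sup_{z\in\mathbb T,\,|\varphi(z)|\le r}|B(\varphi(z))|+\sup_{z\in\mathbb T,\,|\psi(z)|\le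 r}|B(\psi(z))|+\sup_{z\in\mathbb T,\,|\varphi(z)|>r}w(z)+\sup_{z\in\mathbb T,\,|\psi(z)|>r}w(z)\Big)\big(\|C_\varphi\|+\|C_\psi\|\big).$$ Moreover, if the set $\{z\in\mathbb T:\max(|\varphi(z)|,|\psi(z)|)=r\}$ has Lebesgue measure $0$, then the same inequality, with the same $C$, holds with $|\varphi(z)|<r$ and $|\psi(z)|<r$ in place of $|\varphi(z)|\le r$ and $|\psi(z)|\le r$ in the first two suprema. -/

import Mathlib

open scoped ComplexConjugate

/-- The Hardy space `H²` of the unit disc, each function being recorded by the square-summable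
sequence of its Taylor coefficients at `0`, with the norm `‖f‖² = ∑ |aₙ|²`. The function itself
is `HardySpace.eval f`; the lemmas below identify the members of `HardySpace` with the holomorphic
functions on the disc whose quadratic means over the circles `|z| = s < 1` are bounded. -/
abbrev HardySpace : Type := lp (fun _ : ℕ => ℂ) 2

noncomputable section
namespace HardySpace

/-- The holomorphic function on the unit disc with Taylor coefficients `f`. -/
def eval (f : HardySpace) (z : ℂ) : ℂ := ∑' n : ℕ, f n * z ^ n

/-- Parseval's identity on a circle. -/
theorem circleAverage_normSq_hasSum {b : ℕ → ℂ} {s : ℝ} (hs : 0 ≤ s)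
    (hb : Summable fun n => ‖b n‖ * s ^ n) :
    HasSum (fun n => ‖b n‖ ^ 2 * s ^ (2 * n))
      (Real.circleAverage (fun z => ‖∑' n, b n * z ^ n‖ ^ 2) 0 s) := by
  have hT : Fact (0 < 2 * Real.pi) := ⟨Real.two_pi_pos⟩
  set F : ℕ → C(AddCircle (2 * Real.pi), ℂ) := fun n => (b n * (s : ℂ) ^ n) • fourier (n : ℤ)
    with hF
  have hFs : Summable F := by
    refine Summable.of_norm (hb.congr fun n => ?_)
    simp [hF, norm_smul, fourier_norm, abs_of_nonneg hs]
  set G : C(AddCircle (2 * Real.pi), ℂ) := ∑' n, F n with hG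
  have hGs : HasSum F G := hFs.hasSum
  set L := ContinuousMap.toLp (E := ℂ) 2 (AddCircle.haarAddCircle (T := 2 * Real.pi)) ℂ with hL
  have hLs : HasSum (fun n => (b n * (s : ℂ) ^ n) • fourierLp (T := 2 * Real.pi) 2 (n : ℤ)) (L G) := by
    have := hGs.mapL L
    simpa [hF, hL] using this
  have hcoef : ∀ k : ℤ, HasSum (fun n : ℕ => if k = n then b n * (s : ℂ) ^ n else 0)
      (fourierCoeff (L G) k) := by
    intro k
    have h1 := hLs.mapL (innerSL ℂ (fourierLp (T := 2 * Real.pi) 2 k))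
    rw [← fourierBasis_repr, HilbertBasis.repr_apply_apply, coe_fourierBasis]
    have he : (fun n : ℕ => if k = n then b n * (s : ℂ) ^ n else 0) = fun n : ℕ =>
        innerSL ℂ (fourierLp (T := 2 * Real.pi) 2 k)
          ((b n * (s : ℂ) ^ n) • fourierLp (T := 2 * Real.pi) 2 (n : ℤ)) := by
      funext n
      have ho := (orthonormal_iff_ite.1 (orthonormal_fourier (T := 2 * Real.pi))) k n
      rw [innerSL_apply_apply, inner_smul_right, ho]
      split_ifs <;> simp
    rw [he]
    exact h1
  have hp := hasSum_sq_fourierCoeff (L G)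
  have hnat : ∀ n : ℕ, fourierCoeff (L G) (n : ℤ) = b n * (s : ℂ) ^ n := by
    intro n
    refine (hcoef n).unique ?_
    convert hasSum_ite_eq n (b n * (s : ℂ) ^ n) using 2 with m
    by_cases h : m = n
    · subst h; simp
    · simp [h, Ne.symm h]
  have hneg : ∀ k : ℤ, k ∉ Set.range ((↑) : ℕ → ℤ) → ‖fourierCoeff (L G) k‖ ^ 2 = 0 := by
    intro k hk
    have : fourierCoeff (L G) k = 0 := by
      refine (hcoef k).unique ?_
      convert hasSum_zero using 2 with m
      rw [if_neg]
      rintro rfl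
      exact hk ⟨m, rfl⟩
    simp [this]
  rw [← Function.Injective.hasSum_iff Nat.cast_injective hneg] at hp
  convert hp using 1
  · funext n
    simp [hnat, mul_pow, ← pow_mul, mul_comm, abs_of_nonneg hs]
  · have e1 : ∫ t, ‖(L G) t‖ ^ 2 ∂(AddCircle.haarAddCircle (T := 2 * Real.pi))
        = ∫ t, ‖G t‖ ^ 2 ∂(AddCircle.haarAddCircle (T := 2 * Real.pi)) := by
      refine MeasureTheory.integral_congr_ae ?_
      filter_upwards [ContinuousMap.coeFn_toLp (p := 2) (𝕜 := ℂ)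
        (AddCircle.haarAddCircle (T := 2 * Real.pi)) G] with t ht
      rw [hL, ht]
    rw [e1, AddCircle.integral_haarAddCircle, ← AddCircle.intervalIntegral_preimage _ 0,
      Real.circleAverage_def, zero_add]
    congr 1
    refine intervalIntegral.integral_congr fun θ _ => ?_
    have : G (θ : AddCircle (2 * Real.pi)) = ∑' n, F n (θ : AddCircle (2 * Real.pi)) := by
      exact ((ContinuousMap.evalCLM ℂ (θ : AddCircle (2 * Real.pi))).map_tsum hFs)
    simp only [this]
    congr 2
    refine tsum_congr fun n => ?_
    simp only [hF, ContinuousMap.smul_apply, fourier_coe_apply, circleMap_zero, smul_eq_mul,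
      mul_pow, ← Complex.exp_nat_mul]
    rw [mul_assoc]
    congr 3
    push_cast
    field_simp

theorem summable_norm (f : HardySpace) {s : ℝ} (h0 : 0 ≤ s) (h1 : s < 1) :
    Summable fun n => ‖f n‖ * s ^ n := by
  refine Summable.of_nonneg_of_le (fun n => by positivity) (fun n => ?_)
    ((summable_geometric_of_lt_one h0 h1).mul_left ‖f‖)
  gcongr
  exact lp.norm_apply_le_norm (by norm_num) f n

theorem norm_sq_hasSum (f : HardySpace) : HasSum (fun n => ‖f n‖ ^ 2) (‖f‖ ^ 2) := by
  simpa using lp.hasSum_norm (p := 2) (by norm_num) f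

theorem eval_add (f g : HardySpace) {z : ℂ} (hz : z ∈ Metric.ball (0 : ℂ) 1) :
    (f + g).eval z = f.eval z + g.eval z := by
  have hz' : ‖z‖ < 1 := by simpa using hz
  have key : ∀ h : HardySpace, Summable fun n => h n * z ^ n := fun h =>
    Summable.of_norm (by simpa using h.summable_norm (norm_nonneg z) hz')
  unfold eval
  rw [← (key f).tsum_add (key g)]
  simp [add_mul]

theorem eval_smul (c : ℂ) (f : HardySpace) (z : ℂ) : (c • f).eval z = c * f.eval z := by
  simp [eval, mul_assoc, tsum_mul_left]

theorem differentiableOn_eval (f : HardySpace) :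
    DifferentiableOn ℂ f.eval (Metric.ball 0 1) := by
  intro z hz
  have hz' : ‖z‖ < 1 := by simpa using hz
  obtain ⟨s, hs, hs1⟩ := exists_between hz'
  have hs0 : 0 ≤ s := (norm_nonneg z).trans hs.le
  have : DifferentiableOn ℂ f.eval (Metric.ball 0 s) := by
    refine Complex.differentiableOn_tsum_of_summable_norm (f.summable_norm hs0 hs1)
      (fun n => by fun_prop) Metric.isOpen_ball fun n w hw => ?_
    have : ‖w‖ < s := by simpa using hw
    rw [norm_mul, norm_pow]
    gcongr
  exact (this.differentiableAt (Metric.isOpen_ball.mem_nhds (by simpa using hs))).differentiableWithinAt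

theorem circleAverage_le (f : HardySpace) {s : ℝ} (h0 : 0 ≤ s) (h1 : s < 1) :
    Real.circleAverage (fun z => ‖f.eval z‖ ^ 2) 0 s ≤ ‖f‖ ^ 2 := by
  refine hasSum_le (fun n => ?_) (circleAverage_normSq_hasSum h0 (f.summable_norm h0 h1))
    f.norm_sq_hasSum
  exact mul_le_of_le_one_right (by positivity) (pow_le_one₀ h0 h1.le)

/-- An element of `HardySpace` is determined by its function on the disc. -/
theorem eval_injOn {f g : HardySpace} (h : Set.EqOn f.eval g.eval (Metric.ball 0 1)) : f = g := by
  have hs : (0 : ℝ) ≤ 1 / 2 := by norm_num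
  have hfs := f.summable_norm hs (by norm_num)
  have hgs := g.summable_norm hs (by norm_num)
  have hb : Summable fun n => ‖(f - g) n‖ * (1 / 2 : ℝ) ^ n := (f - g).summable_norm hs (by norm_num)
  have h2 := circleAverage_normSq_hasSum hs hb
  have : Real.circleAverage (fun z => ‖∑' n, (f - g) n * z ^ n‖ ^ 2) 0 (1 / 2) = 0 := by
    rw [← Real.circleAverage_const (0 : ℝ) 0 (1 / 2)]
    refine Real.circleAverage_congr_sphere fun z hz => ?_
    have hz' : ‖z‖ = 1 / 2 := by simpa using hz
    have e : ∑' n, (f - g) n * z ^ n = f.eval z - g.eval z := by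
      unfold eval
      rw [← Summable.tsum_sub]
      · simp [sub_mul]
      · refine Summable.of_norm (hfs.congr fun n => ?_)
        simp [hz']
      · refine Summable.of_norm (hgs.congr fun n => ?_)
        simp [hz']
    simp only [e]
    rw [h (by simp [hz']; norm_num)]
    simp
  rw [this] at h2
  have h3 := (hasSum_zero_iff_of_nonneg (fun n => by positivity)).1 h2
  ext n
  have h4 := congrFun h3 n
  have h5 : ‖(f - g) n‖ = 0 := by
    by_contra hne
    have h6 : (0 : ℝ) < ‖(f - g) n‖ ^ 2 * (1 / 2) ^ (2 * n) := by positivity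
    exact h6.ne' h4
  simpa [sub_eq_zero] using h5

/-- A holomorphic function on the disc with bounded quadratic means lies in `HardySpace`. -/
theorem exists_of_circleAverage_le {g : ℂ → ℂ} {M : ℝ} (hM : 0 ≤ M)
    (hg : DifferentiableOn ℂ g (Metric.ball 0 1))
    (h : ∀ s : ℝ, 0 ≤ s → s < 1 → Real.circleAverage (fun z => ‖g z‖ ^ 2) 0 s ≤ M ^ 2) :
    ∃ f : HardySpace, ‖f‖ ≤ M ∧ Set.EqOn f.eval g (Metric.ball 0 1) := by
  set b : ℕ → ℂ := fun n => ((n.factorial : ℂ))⁻¹ * iteratedDeriv n g 0 with hb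
  have hsum : ∀ z ∈ Metric.ball (0 : ℂ) 1, HasSum (fun n => b n * z ^ n) (g z) := by
    intro z hz
    have he : (fun n => b n * z ^ n) = fun n : ℕ =>
        ((n.factorial : ℂ))⁻¹ • (z - 0) ^ n • iteratedDeriv n g 0 := by
      funext n
      simp only [hb, sub_zero, smul_eq_mul]
      ring
    rw [he]
    exact Complex.hasSum_taylorSeries_on_ball hg hz
  have hbs : ∀ s : ℝ, 0 ≤ s → s < 1 → Summable fun n => ‖b n‖ * s ^ n := by
    intro s h0 h1
    have := (hsum (s : ℂ) (by simpa [abs_of_nonneg h0] using h1)).summable.norm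
    refine this.congr fun n => ?_
    simp [abs_of_nonneg h0]
  have hle : ∀ s : ℝ, 0 ≤ s → s < 1 → ∀ N : Finset ℕ,
      ∑ n ∈ N, ‖b n‖ ^ 2 * s ^ (2 * n) ≤ M ^ 2 := by
    intro s h0 h1 N
    have h2 := circleAverage_normSq_hasSum h0 (hbs s h0 h1)
    refine (sum_le_hasSum N (fun n _ => by positivity) h2).trans (le_trans (le_of_eq ?_) (h s h0 h1))
    refine Real.circleAverage_congr_sphere fun z hz => ?_
    have hz' : ‖z‖ = s := by simpa [abs_of_nonneg h0] using hz
    simp only [(hsum z (by simpa [hz'] using h1)).tsum_eq]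
  have hle1 : ∀ N : Finset ℕ, ∑ n ∈ N, ‖b n‖ ^ 2 ≤ M ^ 2 := by
    intro N
    have hc : Filter.Tendsto (fun s : ℝ => ∑ n ∈ N, ‖b n‖ ^ 2 * s ^ (2 * n)) (nhdsWithin 1 (Set.Iio 1))
        (nhds (∑ n ∈ N, ‖b n‖ ^ 2 * 1 ^ (2 * n))) :=
      (Continuous.tendsto (by fun_prop) 1).mono_left nhdsWithin_le_nhds
    simp only [one_pow, mul_one] at hc
    refine le_of_tendsto hc ?_
    filter_upwards [Ioo_mem_nhdsLT (show (0 : ℝ) < 1 by norm_num)] with s hs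
    exact hle s hs.1.le hs.2 N
  have hsq : Summable fun n => ‖b n‖ ^ 2 := summable_of_sum_le (fun n => by positivity) hle1
  refine ⟨⟨b, memℓp_gen (by simpa using hsq)⟩, ?_, fun z hz => (hsum z hz).tsum_eq⟩
  refine lp.norm_le_of_tsum_le (by norm_num) hM ?_
  simpa using hsq.tsum_le_of_sum_le hle1

end HardySpace

/-- Holomorphic self-maps of the open unit disc (the values of `toFun` off the disc are irrelevant). -/
structure DiscSelfMap where
  toFun : ℂ → ℂ
  differentiableOn : DifferentiableOn ℂ toFun (Metric.ball 0 1)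
  mapsTo : Set.MapsTo toFun (Metric.ball 0 1) (Metric.ball 0 1)

namespace DiscSelfMap

instance : CoeFun DiscSelfMap (fun _ => ℂ → ℂ) := ⟨toFun⟩

theorem circleAverage_comp_le (φ : DiscSelfMap) (f : HardySpace) {s : ℝ} (h0 : 0 ≤ s) (h1 : s < 1) :
    Real.circleAverage (fun z => ‖f.eval (φ z)‖ ^ 2) 0 s ≤ (4 / (1 - ‖φ 0‖)) * ‖f‖ ^ 2 := by
  have hp : ‖φ 0‖ < 1 := by simpa using φ.mapsTo (Metric.mem_ball_self one_pos)
  have hsub : Metric.closedBall (0 : ℂ) s ⊆ Metric.ball 0 1 := Metric.closedBall_subset_ball h1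
  have hcφ : ContinuousOn φ (Metric.closedBall 0 s) := φ.differentiableOn.continuousOn.mono hsub
  obtain ⟨z₀, hz₀, hmax⟩ := (isCompact_closedBall (0 : ℂ) s).exists_isMaxOn
    ⟨0, Metric.mem_closedBall_self h0⟩ hcφ.norm
  have hz₀1 : ‖φ z₀‖ < 1 := by simpa using φ.mapsTo (hsub hz₀)
  obtain ⟨R, hR, hR1⟩ := exists_between
    (max_lt hz₀1 (show (1 + ‖φ 0‖) / 2 < 1 by linarith))
  have hRz : ‖φ z₀‖ < R := (le_max_left _ _).trans_lt hR
  have hRp : (1 + ‖φ 0‖) / 2 < R := (le_max_right _ _).trans_lt hR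
  have hR0 : 0 < R := (norm_nonneg _).trans_lt hRz
  have hmaps : Set.MapsTo φ (Metric.closedBall 0 s) (Metric.ball 0 R) := by
    intro z hz
    simpa using (hmax hz).trans_lt hRz
  have hcf : ContinuousOn f.eval (Metric.closedBall 0 R) :=
    f.differentiableOn_eval.continuousOn.mono (Metric.closedBall_subset_ball hR1)
  have hcS : ContinuousOn f.eval (Metric.sphere 0 R) := hcf.mono Metric.sphere_subset_closedBall
  set g : ℂ → ℝ := fun ζ => ‖f.eval ζ‖ ^ 2 with hg
  have hgc : ContinuousOn g (Metric.sphere 0 R) := hcS.norm.pow 2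
  have hgi : CircleIntegrable g 0 R := hgc.circleIntegrable hR0.le
  have hgi' : CircleIntegrable (fun ζ => (g ζ : ℂ)) 0 R :=
    (Complex.continuous_ofReal.comp_continuousOn hgc).circleIntegrable hR0.le
  set G : ℂ → ℂ := fun w =>
    Real.circleAverage (fun ζ => herglotzRieszKernel 0 w ζ • (g ζ : ℂ)) 0 R with hG
  have hGd : DifferentiableOn ℂ G (Metric.ball 0 R) :=
    differentiableOn_circleAverage_herglotzRieszKernel_smul hgi'
  have hGre : ∀ w ∈ Metric.ball (0 : ℂ) R, (G w).re =
      Real.circleAverage ((Complex.re ∘ herglotzRieszKernel 0 w) • g) 0 R := fun w hw =>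
    re_circleAverage_herglotzRieszKernel_smul hgi hw
  have habs : |R| = R := abs_of_pos hR0
  have hPc : ∀ w ∈ Metric.ball (0 : ℂ) R,
      ContinuousOn (Complex.re ∘ herglotzRieszKernel 0 w) (Metric.sphere 0 R) := fun w hw =>
    Complex.continuous_re.comp_continuousOn
      (by simpa [habs] using continuousOn_herglotzRieszKernel_sphere hw)
  have hmajor : ∀ w ∈ Metric.ball (0 : ℂ) R, ‖f.eval w‖ ^ 2 ≤ (G w).re := by
    intro w hw
    have hd : DiffContOnCl ℂ (fun z => f.eval z ^ 2) (Metric.ball 0 R) := by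
      refine DifferentiableOn.diffContOnCl ?_
      rw [closure_ball _ hR0.ne']
      exact (f.differentiableOn_eval.mono (Metric.closedBall_subset_ball hR1)).pow 2
    have hP := hd.circleAverage_re_herglotzRieszKernel_smul hw
    rw [hGre w hw, ← norm_pow, ← hP, Real.circleAverage_def, Real.circleAverage_def, norm_smul]
    have hpi : (0 : ℝ) ≤ (2 * Real.pi)⁻¹ := by positivity
    rw [Real.norm_of_nonneg hpi, smul_eq_mul]
    gcongr
    refine (intervalIntegral.norm_integral_le_integral_norm Real.two_pi_pos.le).trans (le_of_eq ?_)
    refine intervalIntegral.integral_congr fun θ _ => ?_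
    have hpos : 0 ≤ (herglotzRieszKernel 0 w (circleMap 0 R θ)).re := by
      refine le_trans ?_ (le_re_herglotzRieszKernel (circleMap_mem_sphere 0 hR0.le θ) hw)
      have : ‖w - 0‖ < R := by simpa using hw
      exact div_nonneg (by linarith) (by positivity)
    simp [hg, abs_of_nonneg hpos]
  have hcomp : DiffContOnCl ℂ (fun z => G (φ z)) (Metric.ball 0 |s|) := by
    rw [abs_of_nonneg h0]
    refine ⟨hGd.comp (φ.differentiableOn.mono (Metric.ball_subset_closedBall.trans hsub))
      (hmaps.mono_left Metric.ball_subset_closedBall), ?_⟩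
    exact ((hGd.continuousOn.comp hcφ hmaps)).mono Metric.closure_ball_subset_closedBall
  have hGc : ContinuousOn (fun z => G (φ z)) (Metric.sphere 0 s) :=
    (hGd.continuousOn.comp hcφ hmaps).mono Metric.sphere_subset_closedBall
  have hmean : Real.circleAverage (fun z => (G (φ z)).re) 0 s = (G (φ 0)).re := by
    have h2 := Complex.reCLM.circleAverage_comp_comm (hGc.circleIntegrable h0)
    rw [hcomp.circleAverage] at h2
    exact h2
  have hφ0 : φ 0 ∈ Metric.ball (0 : ℂ) R := hmaps (Metric.mem_closedBall_self h0)
  calc Real.circleAverage (fun z => ‖f.eval (φ z)‖ ^ 2) 0 s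
      ≤ Real.circleAverage (fun z => (G (φ z)).re) 0 s := by
        refine Real.circleAverage_mono ?_ ?_ ?_
        · refine ContinuousOn.circleIntegrable h0 ?_
          exact ((hcf.comp hcφ (hmaps.mono_right Metric.ball_subset_closedBall)).mono
            Metric.sphere_subset_closedBall).norm.pow 2
        · exact (Complex.continuous_re.comp_continuousOn hGc).circleIntegrable h0
        · intro z hz
          rw [abs_of_nonneg h0] at hz
          exact hmajor _ (hmaps (Metric.sphere_subset_closedBall hz))
    _ = (G (φ 0)).re := hmean
    _ = Real.circleAverage ((Complex.re ∘ herglotzRieszKernel 0 (φ 0)) • g) 0 R := hGre _ hφ0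
    _ ≤ Real.circleAverage ((4 / (1 - ‖φ 0‖)) • g) 0 R := by
        refine Real.circleAverage_mono (((hPc _ hφ0).mul hgc).circleIntegrable hR0.le)
          ((hgc.const_smul _).circleIntegrable hR0.le) fun z hz => ?_
        rw [habs] at hz
        have hk := re_herglotzRieszKernel_le hz hφ0
        have hk2 : (R + ‖φ 0 - 0‖) / (R - ‖φ 0 - 0‖) ≤ 4 / (1 - ‖φ 0‖) := by
          rw [sub_zero, div_le_div_iff₀ (by linarith) (by linarith)]
          nlinarith [norm_nonneg (φ 0)]
        exact mul_le_mul_of_nonneg_right (hk.trans hk2) (by positivity)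
    _ = (4 / (1 - ‖φ 0‖)) * Real.circleAverage g 0 R := by
        rw [Real.circleAverage_smul, smul_eq_mul]
    _ ≤ (4 / (1 - ‖φ 0‖)) * ‖f‖ ^ 2 := by
        have : 0 ≤ 4 / (1 - ‖φ 0‖) := div_nonneg (by norm_num) (by linarith)
        gcongr
        exact f.circleAverage_le hR0.le hR1

/-- Composition with `φ` maps `HardySpace` boundedly into itself (Littlewood). -/
theorem exists_compositionOperator (φ : DiscSelfMap) :
    ∃ T : HardySpace →L[ℂ] HardySpace,
      ∀ f : HardySpace, Set.EqOn (T f).eval (fun z => f.eval (φ z)) (Metric.ball 0 1) := by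
  have hp : ‖φ 0‖ < 1 := by simpa using φ.mapsTo (Metric.mem_ball_self one_pos)
  have hK : 0 ≤ 4 / (1 - ‖φ 0‖) := div_nonneg (by norm_num) (by linarith)
  have hex : ∀ f : HardySpace, ∃ g : HardySpace, ‖g‖ ≤ √(4 / (1 - ‖φ 0‖)) * ‖f‖ ∧
      Set.EqOn g.eval (fun z => f.eval (φ z)) (Metric.ball 0 1) := by
    intro f
    refine HardySpace.exists_of_circleAverage_le (by positivity)
      (f.differentiableOn_eval.comp φ.differentiableOn φ.mapsTo) fun s h0 h1 => ?_
    rw [mul_pow, Real.sq_sqrt hK]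
    exact φ.circleAverage_comp_le f h0 h1
  choose T hTn hT using hex
  refine ⟨LinearMap.mkContinuous
    { toFun := T
      map_add' := fun f g => HardySpace.eval_injOn fun z hz => ?_
      map_smul' := fun c f => HardySpace.eval_injOn fun z hz => ?_ } _ hTn, hT⟩
  · simp only [HardySpace.eval_add _ _ hz, hT _ hz, HardySpace.eval_add _ _ (φ.mapsTo hz)]
  · simp only [HardySpace.eval_smul, hT _ hz, RingHom.id_apply]

/-- The composition operator `C_φ f = f ∘ φ` on `H²`. -/
def compositionOperator (φ : DiscSelfMap) : HardySpace →L[ℂ] HardySpace :=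
  φ.exists_compositionOperator.choose

theorem eval_compositionOperator (φ : DiscSelfMap) (f : HardySpace) {z : ℂ}
    (hz : z ∈ Metric.ball (0 : ℂ) 1) :
    (φ.compositionOperator f).eval z = f.eval (φ z) :=
  φ.exists_compositionOperator.choose_spec f hz

/-- `a` is the boundary value (radial limit) of `φ` at the point `ζ` of the unit circle. -/
def IsBoundaryValue (φ : DiscSelfMap) (ζ a : ℂ) : Prop :=
  Filter.Tendsto (fun s : ℝ => φ (s * ζ)) (nhdsWithin 1 (Set.Iio 1)) (nhds a)

end DiscSelfMap

/-- The pseudohyperbolic distance `ρ(a, b) = |a - b| / |1 - ā b|`. -/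
def pseudohyperbolicDist (a b : ℂ) : ℝ := ‖a - b‖ / ‖1 - conj a * b‖

/-- On the open unit disc, `B` is a finite Blaschke product with `d` factors. -/
def IsBlaschkeProduct (d : ℕ) (B : ℂ → ℂ) : Prop :=
  ∃ (c : ℂ) (a : Fin d → ℂ), ‖c‖ = 1 ∧ (∀ j, ‖a j‖ < 1) ∧
    ∀ z ∈ Metric.ball (0 : ℂ) 1, B z = c * ∏ j, (z - a j) / (1 - conj (a j) * z)

/-- The `n`-th approximation number `aₙ(T) = inf {‖T - R‖ : rank R < n}`. -/
def approximationNumber {H K : Type*} [NormedAddCommGroup H] [InnerProductSpace ℂ H]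
    [NormedAddCommGroup K] [InnerProductSpace ℂ K] (n : ℕ) (T : H →L[ℂ] K) : ℝ :=
  sInf {x : ℝ | ∃ R : H →L[ℂ] K, LinearMap.rank (R : H →ₗ[ℂ] K) < n ∧ x = ‖T - R‖}

/-- `sup |B(φ(ζ))|` over the points `ζ` of the unit circle at which `φ` has a boundary value that
lies in `A` (and `0` if there is no such point). -/
def supBlaschke (B : ℂ → ℂ) (φ : DiscSelfMap) (A : Set ℂ) : ℝ :=
  sSup {x : ℝ | ∃ ζ a : ℂ, ‖ζ‖ = 1 ∧ φ.IsBoundaryValue ζ a ∧ a ∈ A ∧ x = ‖B a‖}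

/-- `sup ρ(φ(ζ), ψ(ζ))` over the points `ζ` of the unit circle at which `φ` and `ψ` have boundary
values and these satisfy `P` (and `0` if there is no such point). A point where `φ(ζ) = ψ(ζ)` has
modulus one contributes the value `0 / 0 = 0`, that is, nothing. -/
def supDist (φ ψ : DiscSelfMap) (P : ℂ → ℂ → Prop) : ℝ :=
  sSup {x : ℝ | ∃ ζ a b : ℂ, ‖ζ‖ = 1 ∧ φ.IsBoundaryValue ζ a ∧ ψ.IsBoundaryValue ζ b ∧ P a b ∧
    x = pseudohyperbolicDist a b}

end

open Metric Filter Topology MeasureTheory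

/-! Let `V` be multiplication by `B` on H². It is an isometry and `1 - V V*` has rank at most `n -
1`, so comparing `T = C_φ - C_ψ` with `T (1 - V V*)` gives `aₙ(T) ≤ ‖T V‖`. It remains to bound `T
(B g)`, and by density `g` may be a polynomial; then `f = B g` is continuous on the closed disc.

Almost every boundary point, with boundary values `a` of `φ` and `b` of `ψ`, is of one of two kinds.
Either both values lie in the small disc, and `|f(a) - f(b)|²` is at most `2 S₁² |g(a)|² + 2 S₂²
|g(b)|²`, whose integral is controlled by the norms of the composition operators. Or `ρ(a, b) ≤ ε`,
with `ε` the sum of the last two suprema. If `ε ≤ 1/2`, comparing Poisson kernels gives `|f(a) -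
f(b)|² ≤ 144 ε² P[|f|²](a)`. Since `P[|f|²] ∘ φ` is harmonic, its mean is its value at `0`, at most
`4 ‖f‖² / (1 - |φ(0)|²)`, and `1 / (1 - |φ(0)|²) ≤ ‖C_φ‖²` by testing on a reproducing kernel. If `ε
> 1/2`, the bound `aₙ(T) ≤ ‖T‖` suffices.

The pointwise inequality is integrated by Fatou's lemma for the majorants and reverse Fatou for the
bounded function `T f`. This needs radial limits almost everywhere, obtained from almost everywhere
differentiability of a Lipschitz primitive. The carrying lemmas are
`approximationNumber_le_norm_comp`, `sq_norm_sub_le_poissonIntegral`,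
`HardySpace.norm_sq_le_of_ae_limsup_le` and `norm_sq_compositionOperator_sub_le`. -/

/-! ### Radial limits: Fatou's theorem through Lipschitz primitives -/

/-- A Lipschitz function on the closed disc, holomorphic inside, which is `o(|ζ - 1|)` on the circle
near `1`, is small compared with `|z - 1|` up to an exponential barrier. -/
theorem norm_le_mul_exp_of_isLittleO_circle {F : ℂ → ℂ} {M : NNReal} (hL : LipschitzWith M F)
    (hd : DifferentiableOn ℂ F (ball 0 1)) (h1 : F 1 = 0) {ε δ : ℝ} (hε : 0 < ε) (hδ : 0 < δ)
    (hF : ∀ ζ : ℂ, ‖ζ‖ = 1 → ‖ζ - 1‖ < δ → ‖F ζ‖ ≤ ε * ‖ζ - 1‖) :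
    ∃ K : ℝ, 0 ≤ K ∧ ∀ z ∈ ball (0 : ℂ) 1, ‖F z‖ ≤ ε * ‖z - 1‖ * Real.exp (K * (1 - z.re)) := by
  have hM : ∀ z, ‖F z‖ ≤ M * ‖z - 1‖ := fun z => by
    simpa [h1, dist_eq_norm] using hL.dist_le_mul z 1
  -- On the circle `1 - Re ζ = |ζ - 1|² / 2`, which is at least `δ² / 2` away from `1`. This `K`
  -- then makes the barrier exponent at least `M / ε`, enough to absorb the Lipschitz bound.
  refine ⟨2 / δ ^ 2 * (M / ε), by positivity, fun z hz => ?_⟩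
  set K : ℝ := 2 / δ ^ 2 * (M / ε) with hK
  have hre : ∀ z : ℂ, ‖z‖ ≤ 1 → z.re ≤ 1 := fun z hz => (Complex.re_le_norm z).trans hz
  -- The pole is moved to `1 + η`, outside the closed disc, so that the maximum principle applies to
  -- `F(w) e^{-K(1-w)} / (w - 1 - η)`; finally `η → 0`.
  have hη : ∀ η : ℝ, 0 < η → ‖F z‖ ≤ ε * ‖z - 1 - η‖ * Real.exp (K * (1 - z.re)) := by
    intro η hη
    have hne : ∀ w : ℂ, ‖w‖ ≤ 1 → w - 1 - η ≠ 0 := by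
      intro w hw h
      have := congrArg Complex.re h
      simp at this
      linarith [hre w hw]
    have hge : ∀ w : ℂ, ‖w‖ ≤ 1 → ‖w - 1‖ ≤ ‖w - 1 - η‖ := by
      intro w hw
      rw [Complex.norm_def, Complex.norm_def]
      apply Real.sqrt_le_sqrt
      simp only [Complex.normSq_apply, Complex.sub_re, Complex.one_re, Complex.sub_im,
        Complex.one_im, Complex.ofReal_re, Complex.ofReal_im]
      nlinarith [hre w hw]
    have hexp : ∀ w : ℂ, ‖Complex.exp (-K * (1 - w))‖ = Real.exp (-(K * (1 - w.re))) := by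
      intro w
      rw [Complex.norm_exp]
      simp
    have hQ : DiffContOnCl ℂ (fun w => F w / (w - 1 - η) * Complex.exp (-K * (1 - w)))
        (ball 0 1) := by
      constructor
      · refine DifferentiableOn.mul (hd.div (by fun_prop) fun w hw => hne w ?_) (by fun_prop)
        exact (mem_ball_zero_iff.1 hw).le
      · rw [closure_ball _ one_ne_zero]
        refine ContinuousOn.mul (hL.continuous.continuousOn.div (by fun_prop) fun w hw => hne w ?_)
          (by fun_prop)
        simpa using hw
    have := Complex.norm_le_of_forall_mem_frontier_norm_le isBounded_ball hQ (C := ε) ?_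
      (subset_closure hz)
    · rw [norm_mul, norm_div, hexp, Real.exp_neg, ← div_eq_mul_inv, div_div,
        div_le_iff₀ (mul_pos (norm_pos_iff.2 (hne z (mem_ball_zero_iff.1 hz).le))
          (Real.exp_pos _))] at this
      linarith
    · intro w hw
      rw [frontier_ball _ one_ne_zero] at hw
      have hw1 : ‖w‖ = 1 := by simpa using hw
      have hp : 0 < ‖w - 1 - η‖ := norm_pos_iff.2 (hne w hw1.le)
      rw [norm_mul, norm_div, hexp]
      have hwre := hre w hw1.le
      rcases lt_or_ge ‖w - 1‖ δ with h | h
      · have h2 : ‖F w‖ / ‖w - 1 - η‖ ≤ ε := by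
          rw [div_le_iff₀ hp]
          exact (hF w hw1 h).trans (by gcongr; exact hge w hw1.le)
        have h3 : Real.exp (-(K * (1 - w.re))) ≤ 1 := by
          rw [Real.exp_le_one_iff]
          have : 0 ≤ K * (1 - w.re) := mul_nonneg (by positivity) (by linarith)
          linarith
        calc _ ≤ ε * 1 := by gcongr
          _ = ε := mul_one _
      · have h2 : ‖F w‖ / ‖w - 1 - η‖ ≤ M := by
          rw [div_le_iff₀ hp]
          exact (hM w).trans (by gcongr; exact hge w hw1.le)
        have h4 : ‖w - 1‖ ^ 2 = 2 * (1 - w.re) := by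
          have e1 : ‖w‖ ^ 2 = 1 := by rw [hw1]; norm_num
          rw [← Complex.normSq_eq_norm_sq, Complex.normSq_apply] at e1 ⊢
          simp
          nlinarith
        have h5 : (M : ℝ) / ε ≤ K * (1 - w.re) := by
          have h6 : δ ^ 2 ≤ 2 * (1 - w.re) := by rw [← h4]; gcongr
          have h7 : K * (1 - w.re) = (M / ε) * (2 * (1 - w.re) / δ ^ 2) := by
            rw [hK]; field_simp
          rw [h7]
          refine le_mul_of_one_le_right (by positivity) ?_
          rwa [one_le_div (by positivity)]
        have h8 : (M : ℝ) / ε ≤ Real.exp (K * (1 - w.re)) :=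
          (h5.trans (by linarith [Real.add_one_le_exp (K * (1 - w.re))]))
        rw [Real.exp_neg, ← div_eq_mul_inv, div_le_iff₀ (Real.exp_pos _)]
        rw [div_le_iff₀ hε] at h8
        linarith
  have hlim : Tendsto (fun η : ℝ => ε * ‖z - 1 - η‖ * Real.exp (K * (1 - z.re))) (𝓝[>] 0)
      (𝓝 (ε * ‖z - 1 - (0 : ℝ)‖ * Real.exp (K * (1 - z.re)))) :=
    (Continuous.tendsto (by fun_prop) 0).mono_left nhdsWithin_le_nhds
  simp only [Complex.ofReal_zero, sub_zero] at hlim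
  refine ge_of_tendsto hlim ?_
  filter_upwards [self_mem_nhdsWithin] with η h using hη η h

/-- Cauchy's estimate on the disc of centre `s` and radius `(1 - s) / 2`: there `|z - 1|` is
comparable with `1 - s`, and the barrier factor tends to `1` as `s → 1`. -/
theorem tendsto_deriv_of_isLittleO_circle {F : ℂ → ℂ} {M : NNReal} (hL : LipschitzWith M F)
    (hd : DifferentiableOn ℂ F (ball 0 1)) (h1 : F 1 = 0)
    (hF : ∀ ε : ℝ, 0 < ε → ∃ δ : ℝ, 0 < δ ∧
      ∀ ζ : ℂ, ‖ζ‖ = 1 → ‖ζ - 1‖ < δ → ‖F ζ‖ ≤ ε * ‖ζ - 1‖) :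
    Tendsto (fun s : ℝ => deriv F s) (𝓝[<] 1) (𝓝 0) := by
  rw [tendsto_zero_iff_norm_tendsto_zero, Metric.tendsto_nhds]
  intro ε hε
  -- With `|z - 1| ≤ 3(1 - s)/2` and a barrier at most `2`, this gives `|F| ≤ ε(1 - s)/4` on the
  -- Cauchy circle, hence a derivative at most `ε / 2`.
  obtain ⟨δ, hδ, h⟩ := hF (ε / 12) (by positivity)
  obtain ⟨K, hK, hb⟩ := norm_le_mul_exp_of_isLittleO_circle hL hd h1 (by positivity) hδ h
  have hlim : Tendsto (fun s : ℝ => Real.exp (K * (3 / 2 * (1 - s)))) (𝓝[<] 1)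
      (𝓝 (Real.exp (K * (3 / 2 * (1 - 1))))) :=
    (Continuous.tendsto (by fun_prop) 1).mono_left nhdsWithin_le_nhds
  have hlt := hlim.eventually_lt_const (u := 2) (by simp)
  filter_upwards [hlt, Ioo_mem_nhdsLT (show (0 : ℝ) < 1 by norm_num)] with s hs2 hs
  obtain ⟨hs0, hs1⟩ := hs
  have hr : 0 < (1 - s) / 2 := by linarith
  have hsub : closedBall (s : ℂ) ((1 - s) / 2) ⊆ ball 0 1 := by
    refine closedBall_subset_ball' ?_
    simp [abs_of_pos hs0]
    linarith
  have hdc : DiffContOnCl ℂ F (ball (s : ℂ) ((1 - s) / 2)) := by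
    refine DifferentiableOn.diffContOnCl ?_
    rw [closure_ball _ hr.ne']
    exact hd.mono hsub
  have key := Complex.norm_deriv_le_of_forall_mem_sphere_norm_le (C := ε / 4 * (1 - s)) hr hdc ?_
  · have : ε / 4 * (1 - s) / ((1 - s) / 2) = ε / 2 := by
      have : 1 - s ≠ 0 := by linarith
      field_simp
      norm_num
    rw [this] at key
    rw [Real.dist_0_eq_abs, abs_of_nonneg (norm_nonneg _)]
    linarith
  · intro z hz
    have hz1 : ‖z - s‖ = (1 - s) / 2 := by simpa [dist_eq_norm] using hz
    have hz2 : ‖z - 1‖ ≤ 3 / 2 * (1 - s) := by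
      calc ‖z - 1‖ = ‖(z - s) + ((s - 1 : ℝ) : ℂ)‖ := by congr 1; push_cast; ring
        _ ≤ ‖z - s‖ + ‖((s - 1 : ℝ) : ℂ)‖ := norm_add_le _ _
        _ = 3 / 2 * (1 - s) := by
          rw [hz1, Complex.norm_real, Real.norm_of_nonpos (by linarith)]; ring
    have hre : 1 - z.re ≤ ‖z - 1‖ := by
      have := Complex.abs_re_le_norm (z - 1)
      have h2 := neg_abs_le (z - 1).re
      simp at this h2
      linarith
    refine (hb z (hsub (sphere_subset_closedBall hz))).trans ?_
    calc ε / 12 * ‖z - 1‖ * Real.exp (K * (1 - z.re))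
        ≤ ε / 12 * (3 / 2 * (1 - s)) * Real.exp (K * (3 / 2 * (1 - s))) := by
          gcongr
          linarith
      _ ≤ ε / 12 * (3 / 2 * (1 - s)) * 2 := by
          have : 0 ≤ 1 - s := by linarith
          gcongr
      _ = ε / 4 * (1 - s) := by ring

/-- A function whose pullback to the line is `o(θ)` at `0` is `o(ζ - 1)` on the circle at `1`. -/
theorem exists_isLittleO_circle {F : ℂ → ℂ}
    (hF : HasDerivAt (fun θ : ℝ => F (Complex.exp (θ * Complex.I))) 0 0) (h1 : F 1 = 0)
    {ε : ℝ} (hε : 0 < ε) :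
    ∃ δ : ℝ, 0 < δ ∧ ∀ ζ : ℂ, ‖ζ‖ = 1 → ‖ζ - 1‖ < δ → ‖F ζ‖ ≤ ε * ‖ζ - 1‖ := by
  have h := (hasDerivAt_iff_isLittleO.1 hF).def (show 0 < ε * (1 / 2) by positivity)
  simp only [Complex.ofReal_zero, zero_mul, Complex.exp_zero, h1, sub_zero, smul_zero] at h
  have he : HasDerivAt (fun θ : ℝ => Complex.exp (θ * Complex.I)) Complex.I 0 := by
    have := ((Complex.ofRealCLM.hasDerivAt (x := (0 : ℝ))).mul_const Complex.I).cexp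
    simpa using this
  -- The error of `e^{iθ} - 1 ≈ iθ` is at most `|θ| / 2`, whence `|θ| ≤ 2 |ζ - 1|`; the factor `1 /
  -- 2` in `h` compensates for this `2`.
  have h2 := (hasDerivAt_iff_isLittleO.1 he).def (show (0 : ℝ) < 1 / 2 by norm_num)
  simp only [Complex.ofReal_zero, zero_mul, Complex.exp_zero, sub_zero] at h2
  have harg : Tendsto Complex.arg (𝓝 1) (𝓝 0) := by
    have := Complex.continuousAt_arg (x := 1) (by simp)
    simpa [ContinuousAt] using this
  obtain ⟨δ, hδ, hb⟩ := Metric.eventually_nhds_iff.1 (harg.eventually (h.and h2))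
  refine ⟨δ, hδ, fun ζ hζ hd => ?_⟩
  obtain ⟨ha, hb⟩ := hb (y := ζ) (by simpa [dist_eq_norm] using hd)
  have hex : Complex.exp (ζ.arg * Complex.I) = ζ := by
    simpa [hζ] using Complex.norm_mul_exp_arg_mul_I ζ
  rw [hex] at ha hb
  refine ha.trans ?_
  have h3 : ‖ζ.arg • Complex.I‖ = ‖ζ.arg‖ := by simp
  have h4 := norm_sub_norm_le (ζ.arg • Complex.I) (ζ - 1)
  rw [norm_sub_rev (ζ.arg • Complex.I)] at h4
  have : ‖ζ.arg‖ ≤ 2 * ‖ζ - 1‖ := by linarith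
  calc ε * (1 / 2) * ‖ζ.arg‖ ≤ ε * (1 / 2) * (2 * ‖ζ - 1‖) := by gcongr
    _ = ε * ‖ζ - 1‖ := by ring

/-- A holomorphic function with Lipschitz primitive has a radial limit at each point where the
boundary values of the primitive are differentiable. -/
theorem exists_tendsto_deriv_radial {F : ℂ → ℂ} {M : NNReal} (hL : LipschitzWith M F)
    (hd : DifferentiableOn ℂ F (ball 0 1)) {θ₀ : ℝ}
    (hF : DifferentiableAt ℝ (fun θ : ℝ => F (Complex.exp (θ * Complex.I))) θ₀) :
    ∃ a, Tendsto (fun s : ℝ => deriv F (s * Complex.exp (θ₀ * Complex.I))) (𝓝[<] 1) (𝓝 a) := by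
  set ζ₀ := Complex.exp (θ₀ * Complex.I) with hζ
  have hn : ‖ζ₀‖ = 1 := Complex.norm_exp_ofReal_mul_I θ₀
  set d := deriv (fun θ : ℝ => F (Complex.exp (θ * Complex.I))) θ₀ with hdd
  -- Along the circle `z - 1` has derivative `i` at `θ = 0`, so `c i = d`: subtracting `c (z - 1)`
  -- removes the first-order term.
  set c : ℂ := -Complex.I * d with hc
  set E : ℂ → ℂ := fun z => F (ζ₀ * z) - F ζ₀ - c * (z - 1) with hE
  have hmul : LipschitzWith 1 (fun z : ℂ => ζ₀ * z) :=
    LipschitzWith.of_dist_le_mul fun x y => by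
      simp [dist_eq_norm, ← mul_sub, hn]
  have hmulc : LipschitzWith ‖c‖₊ (fun z : ℂ => c * (z - 1)) :=
    LipschitzWith.of_dist_le_mul fun x y => by
      rw [dist_eq_norm, dist_eq_norm, ← mul_sub, norm_mul]; simp
  have hEL : LipschitzWith (M * 1 + 0 + ‖c‖₊) E :=
    ((hL.comp hmul).sub (LipschitzWith.const (F ζ₀))).sub hmulc
  have hmaps : Set.MapsTo (fun z : ℂ => ζ₀ * z) (ball 0 1) (ball 0 1) := by
    intro z hz
    simpa [hn] using hz
  have hFd : DifferentiableOn ℂ (fun z => F (ζ₀ * z)) (ball 0 1) :=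
    hd.comp (by fun_prop) hmaps
  have hEd : DifferentiableOn ℂ E (ball 0 1) := by
    refine (hFd.sub (by fun_prop)).sub (by fun_prop)
  have hE1 : E 1 = 0 := by simp [hE]
  have hder : HasDerivAt (fun θ : ℝ => E (Complex.exp (θ * Complex.I))) 0 0 := by
    have e1 : HasDerivAt (fun θ : ℝ => F (Complex.exp ((θ₀ + θ : ℝ) * Complex.I))) d 0 := by
      have h0 : HasDerivAt (fun θ : ℝ => F (Complex.exp (θ * Complex.I))) d (θ₀ + 0) := by
        rw [add_zero]
        exact hF.hasDerivAt
      exact HasDerivAt.comp_const_add (f := fun θ : ℝ => F (Complex.exp (θ * Complex.I))) θ₀ 0 h0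
    have he : HasDerivAt (fun θ : ℝ => Complex.exp (θ * Complex.I)) Complex.I 0 := by
      have := ((Complex.ofRealCLM.hasDerivAt (x := (0 : ℝ))).mul_const Complex.I).cexp
      simpa using this
    have := (e1.sub_const (F ζ₀)).sub ((he.sub_const 1).const_mul c)
    have hz : d - c * Complex.I = 0 := by
      rw [hc]; linear_combination d * Complex.I_mul_I
    rw [hz] at this
    refine this.congr_of_eventuallyEq (Eventually.of_forall fun θ => ?_)
    simp [hE, hζ, add_mul, Complex.exp_add]
  have key := tendsto_deriv_of_isLittleO_circle hEL hEd hE1 fun ε hε =>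
    exists_isLittleO_circle hder hE1 hε
  have hder2 : ∀ s ∈ Set.Ioo (0 : ℝ) 1, deriv F (s * ζ₀) = ζ₀⁻¹ * (deriv E s + c) := by
    intro s hs
    have hne : ζ₀ ≠ 0 := by
      intro h; simp [h] at hn
    have hs' : (s : ℂ) ∈ ball (0 : ℂ) 1 := by
      simp [abs_of_pos hs.1, hs.2]
    have hFs : HasDerivAt F (deriv F (ζ₀ * s)) (ζ₀ * s) :=
      (hd.differentiableAt (isOpen_ball.mem_nhds (hmaps hs'))).hasDerivAt
    have h1 : HasDerivAt (fun z : ℂ => F (ζ₀ * z)) (deriv F (ζ₀ * s) * ζ₀) s := by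
      have := hFs.comp (s : ℂ) ((hasDerivAt_id (s : ℂ)).const_mul ζ₀)
      simpa [Function.comp_def] using this
    have h2 : HasDerivAt E (deriv F (ζ₀ * s) * ζ₀ - c) s := by
      have := (h1.sub_const (F ζ₀)).sub (((hasDerivAt_id' (s : ℂ)).sub_const 1).const_mul c)
      rwa [mul_one] at this
    rw [h2.deriv, mul_comm (s : ℂ)]
    field_simp
    ring
  refine ⟨ζ₀⁻¹ * (0 + c), ((key.add_const c).const_mul ζ₀⁻¹).congr' ?_⟩
  filter_upwards [Ioo_mem_nhdsLT (show (0 : ℝ) < 1 by norm_num)] with s hs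
  exact (hder2 s hs).symm

/-- **Fatou's theorem** for holomorphic self-maps of the disc: radial limits exist almost
everywhere. -/
theorem DiscSelfMap.ae_exists_isBoundaryValue (φ : DiscSelfMap) :
    ∀ᵐ θ : ℝ, ∃ a, φ.IsBoundaryValue (Complex.exp (θ * Complex.I)) a := by
  -- A primitive of `φ` is 1-Lipschitz because `|φ| < 1`. After a Lipschitz extension to the plane,
  -- its restriction to the circle is Lipschitz in the angle, hence differentiable almost
  -- everywhere.
  obtain ⟨Φ, hΦ⟩ := φ.differentiableOn.isExactOn_ball
  have hLip : LipschitzOnWith 1 Φ (ball 0 1) := by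
    refine (convex_ball (0 : ℂ) 1).lipschitzOnWith_of_nnnorm_hasDerivWithin_le
      (fun z hz => (hΦ z hz).hasDerivWithinAt) fun z hz => ?_
    have : ‖φ z‖ < 1 := by simpa using φ.mapsTo hz
    exact_mod_cast this.le
  obtain ⟨F, hF, hFe⟩ := hLip.extend_finite_dimension
  have hFd : ∀ z ∈ ball (0 : ℂ) 1, HasDerivAt F (φ z) z := fun z hz =>
    (hΦ z hz).congr_of_eventuallyEq
      (hFe.symm.eventuallyEq_of_mem (isOpen_ball.mem_nhds hz))
  have hexp : LipschitzWith 1 (fun θ : ℝ => Complex.exp (θ * Complex.I)) := by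
    refine lipschitzWith_of_nnnorm_deriv_le (by fun_prop) fun θ => ?_
    have he := ((Complex.ofRealCLM.hasDerivAt (x := θ)).mul_const Complex.I).cexp
    simp only [Complex.ofRealCLM_apply] at he
    rw [he.deriv, ← NNReal.coe_le_coe]
    simp
  filter_upwards [(hF.comp hexp).ae_differentiableAt_real] with θ hθ
  obtain ⟨a, ha⟩ := exists_tendsto_deriv_radial hF
    (fun z hz => (hFd z hz).differentiableAt.differentiableWithinAt) hθ
  refine ⟨a, ha.congr' ?_⟩
  filter_upwards [Ioo_mem_nhdsLT (show (0 : ℝ) < 1 by norm_num)] with s hs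
  refine (hFd _ ?_).deriv
  simp [abs_of_pos hs.1, hs.2]

/-! ### The shift, reproducing kernels and multiplication by Blaschke products -/

namespace HardySpace

theorem summable_eval (f : HardySpace) {z : ℂ} (hz : ‖z‖ < 1) : Summable fun n => f n * z ^ n :=
  Summable.of_norm (by simpa using f.summable_norm (norm_nonneg z) hz)

/-- The unilateral shift, that is, multiplication by `z`. -/
noncomputable def shift : HardySpace →ₗᵢ[ℂ] HardySpace where
  toFun f := ⟨fun n => Nat.casesOn n 0 f, memℓp_gen (by
    rw [← summable_nat_add_iff 1]
    simpa using f.norm_sq_hasSum.summable)⟩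
  map_add' f g := by
    ext n
    cases n with
    | zero => exact (add_zero (0 : ℂ)).symm
    | succ n => rfl
  map_smul' c f := by ext n; cases n <;> simp
  norm_map' f := by
    rw [← sq_eq_sq₀ (norm_nonneg _) (norm_nonneg _)]
    refine (norm_sq_hasSum _).unique ?_
    rw [← hasSum_nat_add_iff' 1]
    simpa using f.norm_sq_hasSum

@[simp] theorem shift_zero (f : HardySpace) : shift f 0 = 0 := rfl

@[simp] theorem shift_succ (f : HardySpace) (n : ℕ) : shift f (n + 1) = f n := rfl

theorem eval_shift (f : HardySpace) {z : ℂ} (hz : ‖z‖ < 1) :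
    (shift f).eval z = z * f.eval z := by
  unfold eval
  rw [((shift f).summable_eval hz).tsum_eq_zero_add, ← tsum_mul_left]
  simp only [shift_zero, zero_mul, zero_add, shift_succ]
  exact tsum_congr fun n => by ring

theorem eval_sub (f g : HardySpace) {z : ℂ} (hz : ‖z‖ < 1) :
    (f - g).eval z = f.eval z - g.eval z := by
  unfold eval
  rw [← (f.summable_eval hz).tsum_sub (g.summable_eval hz)]
  simp [sub_mul]

theorem eval_zero (f : HardySpace) : f.eval 0 = f 0 := by
  unfold eval
  rw [tsum_eq_single 0 (fun n hn => by simp [hn])]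
  simp

theorem hasSum_kernel {a : ℂ} (ha : ‖a‖ < 1) :
    HasSum (fun n : ℕ => ‖conj a ^ n‖ ^ 2) (1 - ‖a‖ ^ 2)⁻¹ := by
  have : ‖a‖ ^ 2 < 1 := by nlinarith [norm_nonneg a]
  refine (hasSum_geometric_of_lt_one (by positivity) this).congr_fun fun n => ?_
  simp [← pow_mul, mul_comm]

/-- The reproducing kernel at the point `a` of the disc. -/
noncomputable def kernel (a : ℂ) (ha : ‖a‖ < 1) : HardySpace :=
  ⟨fun n => conj a ^ n, memℓp_gen (by simpa using (hasSum_kernel ha).summable)⟩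

theorem kernel_apply {a : ℂ} (ha : ‖a‖ < 1) (n : ℕ) : kernel a ha n = conj a ^ n := rfl

theorem norm_sq_kernel {a : ℂ} (ha : ‖a‖ < 1) : ‖kernel a ha‖ ^ 2 = (1 - ‖a‖ ^ 2)⁻¹ :=
  (norm_sq_hasSum _).unique (hasSum_kernel ha)

theorem eval_kernel_self {a : ℂ} (ha : ‖a‖ < 1) :
    (kernel a ha).eval a = ((1 - ‖a‖ ^ 2)⁻¹ : ℝ) := by
  refine HasSum.tsum_eq ?_
  have := (Complex.hasSum_ofReal.2 (hasSum_kernel ha))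
  refine this.congr_fun fun n => ?_
  rw [kernel_apply, ← mul_pow, ← Complex.normSq_eq_conj_mul_self, Complex.normSq_eq_norm_sq]
  simp [← pow_mul, mul_comm]

end HardySpace

open ContinuousLinearMap in
theorem isometry_adjoint_comp_self {H : Type*} [NormedAddCommGroup H] [InnerProductSpace ℂ H]
    [CompleteSpace H] {V : H →L[ℂ] H} (hV : ∀ x, ‖V x‖ = ‖x‖) (x : H) : adjoint V (V x) = x := by
  have := (norm_map_iff_adjoint_comp_self V).1 hV
  exact DFunLike.congr_fun this x

/-- In the expanded squares the cross terms are real parts of conjugate numbers. For the shift this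
says that `(z - a) g` and `(1 - ā z) g` have the same norm, the Hilbert space form of `|z - a| = |1
- ā z|` on the circle. -/
theorem norm_sub_smul_eq_of_isometry {H : Type*} [NormedAddCommGroup H] [InnerProductSpace ℂ H]
    {S : H → H} (hS : ∀ x, ‖S x‖ = ‖x‖) (a : ℂ) (x : H) :
    ‖S x - a • x‖ = ‖x - conj a • S x‖ := by
  rw [← sq_eq_sq₀ (norm_nonneg _) (norm_nonneg _), norm_sub_sq (𝕜 := ℂ), norm_sub_sq (𝕜 := ℂ),
    norm_smul, norm_smul, hS, inner_smul_right, inner_smul_right, ← inner_conj_symm x (S x),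
    ← map_mul, RCLike.conj_re, RCLike.norm_conj]

/-- Multiplication by a Blaschke factor is an isometry whose range has codimension at most one. -/
theorem HardySpace.exists_blaschkeFactor {a : ℂ} (ha : ‖a‖ < 1) :
    ∃ V : HardySpace →L[ℂ] HardySpace, (∀ f, ‖V f‖ = ‖f‖) ∧
      (∀ f : HardySpace, ∀ z : ℂ, ‖z‖ < 1 →
        (V f).eval z = (z - a) / (1 - conj a * z) * f.eval z) ∧
      LinearMap.rank ((1 - V ∘L ContinuousLinearMap.adjoint V : HardySpace →L[ℂ] HardySpace) :
        HardySpace →ₗ[ℂ] HardySpace) ≤ 1 := by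
  set S : HardySpace →L[ℂ] HardySpace := shift.toContinuousLinearMap with hS
  have hSf : ∀ f, S f = shift f := fun f => rfl
  have hSn : ∀ f, ‖S f‖ = ‖f‖ := shift.norm_map
  have hlt : ‖conj a • S‖ < 1 := by
    rw [norm_smul, RCLike.norm_conj]
    have : ‖S‖ ≤ 1 := S.opNorm_le_bound zero_le_one fun f => by simp [hSn]
    nlinarith [norm_nonneg a]
  -- Since `‖ā S‖ < 1`, a Neumann series inverts `1 - ā S`, and `V = (S - a)(1 - ā S)⁻¹` is
  -- multiplication by the Blaschke factor.
  set U := Units.oneSub (conj a • S) hlt with hU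
  have hUv : (U : HardySpace →L[ℂ] HardySpace) = 1 - conj a • S := rfl
  set D : HardySpace →L[ℂ] HardySpace := S - a • 1 with hD
  have hcomm : Commute D U := by
    rw [hUv, hD]
    refine Commute.sub_left ?_ ?_
    · exact (Commute.one_right _).sub_right ((Commute.refl S).smul_right _)
    · exact (Commute.one_left _).smul_left _
  set V : HardySpace →L[ℂ] HardySpace := D * (U⁻¹ : (HardySpace →L[ℂ] HardySpace)ˣ) with hV
  have hUV : ∀ f, V f - conj a • S (V f) = S f - a • f := by
    have : (U : HardySpace →L[ℂ] HardySpace) * V = D := by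
      rw [hV, ← mul_assoc, ← hcomm.eq, mul_assoc, Units.mul_inv, mul_one]
    intro f
    simpa [hUv, hD] using DFunLike.congr_fun this f
  have hVU : ∀ f, V (f - conj a • S f) = S f - a • f := by
    have : V * (U : HardySpace →L[ℂ] HardySpace) = D := by
      rw [hV, mul_assoc, Units.inv_mul, mul_one]
    intro f
    simpa [hUv, hD] using DFunLike.congr_fun this f
  have hsurj : ∀ f : HardySpace, ∃ g, g - conj a • S g = f := fun f => by
    refine ⟨(U⁻¹ : (HardySpace →L[ℂ] HardySpace)ˣ).val f, ?_⟩
    simpa [hUv] using DFunLike.congr_fun (Units.mul_inv U) f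
  have hVn : ∀ f, ‖V f‖ = ‖f‖ := by
    intro f
    obtain ⟨g, rfl⟩ := hsurj f
    rw [hVU, norm_sub_smul_eq_of_isometry hSn]
  refine ⟨V, hVn, fun f z hz => ?_, ?_⟩
  · have h1 := congrArg (fun g : HardySpace => g.eval z) (hUV f)
    simp only [eval_sub _ _ hz, eval_smul, hSf, eval_shift _ hz] at h1
    have hne : 1 - conj a * z ≠ 0 := by
      intro h
      have h2 : ‖conj a * z‖ < 1 := by
        rw [norm_mul, RCLike.norm_conj]
        nlinarith [norm_nonneg a, norm_nonneg z]
      rw [← sub_eq_zero.1 h] at h2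
      simp at h2
    rw [div_mul_eq_mul_div, eq_div_iff hne]
    linear_combination h1
  · have hr : LinearMap.range ((1 - V ∘L ContinuousLinearMap.adjoint V :
        HardySpace →L[ℂ] HardySpace) : HardySpace →ₗ[ℂ] HardySpace) ≤
        Submodule.span ℂ {kernel a ha} := by
      rintro x ⟨y, hy⟩
      have hx : ∀ g, inner ℂ (V g) x = 0 := by
        intro g
        have hy' : x = y - V (ContinuousLinearMap.adjoint V y) := hy.symm
        rw [← ContinuousLinearMap.adjoint_inner_right, hy', map_sub,
          isometry_adjoint_comp_self hVn, sub_self, inner_zero_right]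
      -- `V` sends `eₙ - ā eₙ₊₁` to `eₙ₊₁ - a eₙ`. Orthogonality to the range of `V` thus forces a
      -- geometric sequence, a multiple of the reproducing kernel at `a`.
      have hrec : ∀ n, x (n + 1) = conj a * x n := by
        intro n
        have h1 := hx (lp.single 2 n 1 - conj a • S (lp.single 2 n 1))
        have h2 : S (lp.single 2 n 1) = lp.single 2 (n + 1) (1 : ℂ) := by
          ext m
          cases m with
          | zero => simp [hSf, lp.single_apply]
          | succ m => simp [hSf, lp.single_apply, Pi.single_apply]
        rw [hVU, inner_sub_left, inner_smul_left, h2, lp.inner_single_left,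
          lp.inner_single_left] at h1
        simpa [sub_eq_zero] using h1
      refine Submodule.mem_span_singleton.2 ⟨x 0, ?_⟩
      ext n
      induction n with
      | zero => simp [kernel_apply]
      | succ n ih =>
        rw [hrec, ← ih]
        simp [kernel_apply]
        ring
    exact (Submodule.rank_mono hr).trans ((rank_span_le _).trans (by simp))

/-- Induction on the factors through `1 - V W W* V* = (1 - V V*) + V (1 - W W*) V*`, so each factor
adds at most one to the rank. -/
theorem HardySpace.exists_blaschkeProduct (d : ℕ) (a : Fin d → ℂ) (ha : ∀ j, ‖a j‖ < 1) :
    ∃ V : HardySpace →L[ℂ] HardySpace, (∀ f, ‖V f‖ = ‖f‖) ∧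
      (∀ f : HardySpace, ∀ z : ℂ, ‖z‖ < 1 →
        (V f).eval z = (∏ j, (z - a j) / (1 - conj (a j) * z)) * f.eval z) ∧
      LinearMap.rank ((1 - V ∘L ContinuousLinearMap.adjoint V : HardySpace →L[ℂ] HardySpace) :
        HardySpace →ₗ[ℂ] HardySpace) ≤ d := by
  induction d with
  | zero =>
    refine ⟨1, fun f => rfl, fun f z _ => by simp, ?_⟩
    have : (1 - 1 ∘L ContinuousLinearMap.adjoint (1 : HardySpace →L[ℂ] HardySpace) :
        HardySpace →L[ℂ] HardySpace) = 0 := by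
      have h : ContinuousLinearMap.adjoint (1 : HardySpace →L[ℂ] HardySpace) = 1 := by
        rw [← ContinuousLinearMap.star_eq_adjoint, star_one]
      rw [h]
      exact sub_self _
    rw [this]
    simp
  | succ d ih =>
    obtain ⟨V, hVn, hVe, hVr⟩ := exists_blaschkeFactor (ha 0)
    obtain ⟨W, hWn, hWe, hWr⟩ := ih (fun j => a j.succ) fun j => ha _
    refine ⟨V ∘L W, fun f => by simp [hVn, hWn], fun f z hz => ?_, ?_⟩
    · rw [Fin.prod_univ_succ, ContinuousLinearMap.comp_apply, hVe _ z hz, hWe _ z hz, mul_assoc]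
    · set A := ContinuousLinearMap.adjoint V
      have e : (1 - (V ∘L W) ∘L ContinuousLinearMap.adjoint (V ∘L W) :
          HardySpace →L[ℂ] HardySpace) = (1 - V ∘L A) +
          V ∘L ((1 - W ∘L ContinuousLinearMap.adjoint W) ∘L A) := by
        rw [ContinuousLinearMap.adjoint_comp]
        ext1 f
        simp [A]
      rw [e, ContinuousLinearMap.toLinearMap_add, ContinuousLinearMap.toLinearMap_comp,
        ContinuousLinearMap.toLinearMap_comp]
      refine (LinearMap.rank_add_le _ _).trans ?_
      rw [Nat.cast_add, Nat.cast_one, add_comm]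
      refine add_le_add ?_ hVr
      exact (LinearMap.rank_comp_le_right _ _).trans ((LinearMap.rank_comp_le_left _ _).trans hWr)

/-! ### Approximation numbers -/

section ApproximationNumber

variable {H : Type*} [NormedAddCommGroup H] [InnerProductSpace ℂ H]

theorem approximationNumber_le {n : ℕ} (T R : H →L[ℂ] H)
    (hR : LinearMap.rank (R : H →ₗ[ℂ] H) < n) : approximationNumber n T ≤ ‖T - R‖ :=
  csInf_le ⟨0, by rintro _ ⟨R, -, rfl⟩; exact norm_nonneg _⟩ ⟨R, hR, rfl⟩

theorem approximationNumber_le_norm {n : ℕ} (hn : 1 ≤ n) (T : H →L[ℂ] H) :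
    approximationNumber n T ≤ ‖T‖ := by
  simpa using approximationNumber_le T 0 (n := n) (by
    rw [ContinuousLinearMap.toLinearMap_zero, LinearMap.rank_zero]
    exact_mod_cast hn)

/-- The competitor `R = T (1 - V V*)` leaves `T - R = T V V*`, and `‖V*‖ ≤ 1`. -/
theorem approximationNumber_le_norm_comp [CompleteSpace H] {n : ℕ} (T V : H →L[ℂ] H)
    (hV : ∀ x, ‖V x‖ = ‖x‖) (hr : LinearMap.rank
      ((1 - V ∘L ContinuousLinearMap.adjoint V : H →L[ℂ] H) : H →ₗ[ℂ] H) < n) :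
    approximationNumber n T ≤ ‖T ∘L V‖ := by
  have h1 := approximationNumber_le T (T ∘L (1 - V ∘L ContinuousLinearMap.adjoint V)) (n := n)
    (by
      rw [ContinuousLinearMap.toLinearMap_comp]
      exact (LinearMap.rank_comp_le_right _ _).trans_lt hr)
  have h2 : T - T ∘L (1 - V ∘L ContinuousLinearMap.adjoint V) =
      (T ∘L V) ∘L ContinuousLinearMap.adjoint V := by
    ext1 x
    simp
  rw [h2] at h1
  refine h1.trans ((ContinuousLinearMap.opNorm_comp_le _ _).trans ?_)
  refine mul_le_of_le_one_right (norm_nonneg _) ?_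
  rw [LinearIsometryEquiv.norm_map]
  exact V.opNorm_le_bound zero_le_one fun x => by simp [hV]

end ApproximationNumber

/-! ### Pseudohyperbolic distance and Poisson integrals -/

theorem norm_one_sub_conj_mul_pos {a b : ℂ} (ha : ‖a‖ < 1) (hb : ‖b‖ < 1) :
    0 < ‖1 - conj a * b‖ := by
  refine norm_pos_iff.2 fun h => ?_
  have h2 : ‖conj a * b‖ < 1 := by
    rw [norm_mul, RCLike.norm_conj]
    nlinarith [norm_nonneg a, norm_nonneg b]
  rw [← sub_eq_zero.1 h] at h2
  simp at h2

theorem pseudohyperbolicDist_nonneg (a b : ℂ) : 0 ≤ pseudohyperbolicDist a b :=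
  div_nonneg (norm_nonneg _) (norm_nonneg _)

theorem pseudohyperbolicDist_comm (a b : ℂ) :
    pseudohyperbolicDist a b = pseudohyperbolicDist b a := by
  unfold pseudohyperbolicDist
  rw [norm_sub_rev, ← RCLike.norm_conj (1 - conj a * b)]
  simp [mul_comm]

/-- For `|a| = 1`, `1 - ā b = ā (a - b)`. Hence distinct boundary values at distance at most `1/2`
must both lie in the open disc. -/
theorem pseudohyperbolicDist_of_norm_eq_one {a b : ℂ} (ha : ‖a‖ = 1) (hab : a ≠ b) :
    pseudohyperbolicDist a b = 1 := by
  have h : conj a * a = 1 := by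
    rw [← Complex.normSq_eq_conj_mul_self, Complex.normSq_eq_norm_sq, ha]; simp
  have h2 : ‖1 - conj a * b‖ = ‖a - b‖ := by
    rw [← h, ← mul_sub, norm_mul, RCLike.norm_conj, ha, one_mul]
  rw [pseudohyperbolicDist, h2, div_self (norm_ne_zero_iff.2 (sub_ne_zero.2 hab))]

theorem pseudohyperbolicDist_le_one {a b : ℂ} (ha : ‖a‖ ≤ 1) (hb : ‖b‖ ≤ 1) :
    pseudohyperbolicDist a b ≤ 1 := by
  refine div_le_one_of_le₀ ?_ (norm_nonneg _)
  rw [← sq_le_sq₀ (norm_nonneg _) (norm_nonneg _)]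
  have h1 : ‖a‖ ^ 2 ≤ 1 := by nlinarith [norm_nonneg a]
  have h2 : ‖b‖ ^ 2 ≤ 1 := by nlinarith [norm_nonneg b]
  simp only [← Complex.normSq_eq_norm_sq, Complex.normSq_apply] at *
  simp
  nlinarith

/-- Comparison of Herglotz kernels at two pseudohyperbolically close points. -/
theorem norm_herglotzRieszKernel_sub_le {a b x : ℂ} (ha : ‖a‖ < 1) (hb : ‖b‖ < 1) (hx : ‖x‖ = 1)
    (hab : pseudohyperbolicDist a b ≤ 1 / 2) :
    ‖herglotzRieszKernel 0 b x - herglotzRieszKernel 0 a x‖ ≤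
      12 * pseudohyperbolicDist a b * poissonKernel 0 a x := by
  set D := ‖1 - conj a * b‖ with hD
  set ρ := pseudohyperbolicDist a b with hρ
  have hρ0 : 0 ≤ ρ := pseudohyperbolicDist_nonneg a b
  have hD0 : 0 < D := norm_one_sub_conj_mul_pos ha hb
  have hd : ‖a - b‖ = ρ * D := by
    rw [hρ, pseudohyperbolicDist, div_mul_cancel₀ _ hD0.ne']
  have hxa : 0 < ‖x - a‖ := norm_pos_iff.2 (sub_ne_zero.2 (by rintro rfl; linarith))
  have hxb : 0 < ‖x - b‖ := norm_pos_iff.2 (sub_ne_zero.2 (by rintro rfl; linarith))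
  have hself : ∀ z : ℂ, ‖z‖ < 1 → ‖1 - conj z * z‖ = 1 - ‖z‖ ^ 2 := by
    intro z hz
    rw [← Complex.normSq_eq_conj_mul_self, Complex.normSq_eq_norm_sq, ← Complex.ofReal_one,
      ← Complex.ofReal_sub, Complex.norm_real, Real.norm_of_nonneg]
    nlinarith [norm_nonneg z]
  have hρD : ρ * D ≤ 1 / 2 * D := by gcongr
  -- In this and the next two bounds `|a - b| ≤ D / 2` is absorbed: `D` is dominated by `1 - |a|²`
  -- and by `|x - b|`, and so `|x - a|` by `|x - b|`. The constant is `12 = 2 · 2 · 3`, the first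
  -- `2` coming from the difference of the two kernels.
  have h1 : D ≤ 2 * (1 - ‖a‖ ^ 2) := by
    have e : 1 - conj a * b = (1 - conj a * a) + conj a * (a - b) := by ring
    have h : D ≤ (1 - ‖a‖ ^ 2) + ‖a‖ * ‖a - b‖ := by
      rw [hD, e, ← hself a ha, ← RCLike.norm_conj a, ← norm_mul]
      exact norm_add_le _ _
    nlinarith [norm_nonneg a, norm_nonneg (a - b)]
  have h2 : D ≤ 4 * ‖x - b‖ := by
    have e : 1 - conj a * b = (1 - conj b * b) - conj (a - b) * b := by
      rw [map_sub]; ring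
    have h : D ≤ (1 - ‖b‖ ^ 2) + ‖a - b‖ * ‖b‖ := by
      rw [hD, e, ← hself b hb, ← RCLike.norm_conj (a - b), ← norm_mul]
      exact norm_sub_le _ _
    have h3 : 1 - ‖b‖ ≤ ‖x - b‖ := by
      have := norm_sub_norm_le x b
      rwa [hx] at this
    nlinarith [norm_nonneg b, norm_nonneg (a - b)]
  have h3 : ‖x - a‖ ≤ 3 * ‖x - b‖ := by
    have : ‖x - a‖ ≤ ‖x - b‖ + ‖a - b‖ := by
      have e : x - a = (x - b) - (a - b) := by ring
      rw [e]; exact norm_sub_le _ _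
    linarith
  have hxa' : x - a ≠ 0 := norm_pos_iff.1 hxa
  have hxb' : x - b ≠ 0 := norm_pos_iff.1 hxb
  have e : herglotzRieszKernel 0 b x - herglotzRieszKernel 0 a x =
      2 * x * (b - a) / ((x - b) * (x - a)) := by
    simp only [herglotzRieszKernel_def, sub_zero]
    rw [div_sub_div _ _ hxb' hxa']
    ring
  rw [e, norm_div, norm_mul, norm_mul, norm_mul, norm_sub_rev b a, hx, poissonKernel_def, hd]
  simp only [sub_zero, hx, one_pow, mul_one, Complex.norm_ofNat]
  rw [← mul_div_assoc, div_le_div_iff₀ (mul_pos hxb hxa) (by positivity)]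
  have h4 : D * ‖x - a‖ ≤ 2 * (1 - ‖a‖ ^ 2) * (3 * ‖x - b‖) :=
    mul_le_mul h1 h3 hxa.le (hD0.le.trans h1)
  calc 2 * (ρ * D) * ‖x - a‖ ^ 2 = 2 * ρ * ‖x - a‖ * (D * ‖x - a‖) := by ring
    _ ≤ 2 * ρ * ‖x - a‖ * (2 * (1 - ‖a‖ ^ 2) * (3 * ‖x - b‖)) := by gcongr
    _ = 12 * ρ * (1 - ‖a‖ ^ 2) * (‖x - b‖ * ‖x - a‖) := by ring

theorem continuousOn_poissonKernel_sphere {a : ℂ} (ha : ‖a‖ < 1) :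
    ContinuousOn (poissonKernel 0 a) (sphere 0 1) := by
  rw [poissonKernel_eq_re_herglotzRieszKernel]
  have := continuousOn_herglotzRieszKernel_sphere (c := 0) (R := 1) (w := a) (by simpa using ha)
  rw [abs_one] at this
  exact Complex.continuous_re.comp_continuousOn this

theorem poissonKernel_nonneg {a x : ℂ} (ha : ‖a‖ < 1) (hx : ‖x‖ = 1) :
    0 ≤ poissonKernel 0 a x := by
  rw [poissonKernel_def]
  simp only [sub_zero, hx]
  refine div_nonneg ?_ (by positivity)
  nlinarith [norm_nonneg a]

theorem norm_circleAverage_le_of_norm_le {f : ℂ → ℂ} {g : ℂ → ℝ} (hg : CircleIntegrable g 0 1)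
    (h : ∀ x : ℂ, ‖x‖ = 1 → ‖f x‖ ≤ g x) :
    ‖Real.circleAverage f 0 1‖ ≤ Real.circleAverage g 0 1 := by
  rw [Real.circleAverage_def, Real.circleAverage_def, norm_smul,
    Real.norm_of_nonneg (by positivity), smul_eq_mul]
  gcongr
  refine intervalIntegral.norm_integral_le_of_norm_le Real.two_pi_pos.le
    (Eventually.of_forall fun θ _ => h _ (by simp)) hg

theorem DiffContOnCl.continuousOn_unit_sphere {f : ℂ → ℂ} (hf : DiffContOnCl ℂ f (ball 0 1)) :
    ContinuousOn f (sphere 0 1) :=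
  (closure_ball (0 : ℂ) one_ne_zero ▸ hf.continuousOn).mono sphere_subset_closedBall

/-- Both values are Poisson integrals of `f` over the circle, and the two kernels differ by at most
`12 ρ` times the one at `a`. -/
theorem norm_sub_le_poissonIntegral {f : ℂ → ℂ} (hf : DiffContOnCl ℂ f (ball 0 1))
    {a b : ℂ} (ha : ‖a‖ < 1) (hb : ‖b‖ < 1)
    (hab : pseudohyperbolicDist a b ≤ 1 / 2) :
    ‖f a - f b‖ ≤ 12 * pseudohyperbolicDist a b *
      Real.circleAverage (fun x => poissonKernel 0 a x * ‖f x‖) 0 1 := by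
  have hc := hf.continuousOn_unit_sphere
  have hka := continuousOn_poissonKernel_sphere ha
  have hkb := continuousOn_poissonKernel_sphere hb
  have e : f b - f a = Real.circleAverage (poissonKernel 0 b • f - poissonKernel 0 a • f) 0 1 := by
    rw [Real.circleAverage_sub ((hkb.smul hc).circleIntegrable zero_le_one)
      ((hka.smul hc).circleIntegrable zero_le_one),
      hf.circleAverage_poissonKernel_smul (by simpa using hb),
      hf.circleAverage_poissonKernel_smul (by simpa using ha)]
  rw [norm_sub_rev, e, ← smul_eq_mul, ← Real.circleAverage_fun_smul]
  refine norm_circleAverage_le_of_norm_le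
    ((continuousOn_const.mul (hka.mul hc.norm)).circleIntegrable zero_le_one) fun x hx => ?_
  have h1 : (poissonKernel 0 b • f - poissonKernel 0 a • f) x =
      (poissonKernel 0 b x - poissonKernel 0 a x) • f x := by
    simp [sub_smul]
  rw [h1, norm_smul, smul_eq_mul, ← mul_assoc]
  gcongr
  refine le_trans ?_ (norm_herglotzRieszKernel_sub_le ha hb hx hab)
  rw [poissonKernel_eq_re_herglotzRieszKernel, poissonKernel_eq_re_herglotzRieszKernel,
    Function.comp_apply, Function.comp_apply, ← Complex.sub_re]
  exact Complex.abs_re_le_norm _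

/-- Jensen's inequality: the Poisson kernel has mean `1`, so integrating `P (|f| - m)² ≥ 0` with `m`
the mean of `|f|` gives the claim. -/
theorem sq_poissonIntegral_le {f : ℂ → ℂ} (hf : DiffContOnCl ℂ f (ball 0 1))
    {a : ℂ} (ha : ‖a‖ < 1) :
    Real.circleAverage (fun x => poissonKernel 0 a x * ‖f x‖) 0 1 ^ 2 ≤
      Real.circleAverage (fun x => poissonKernel 0 a x * ‖f x‖ ^ 2) 0 1 := by
  have hc := hf.continuousOn_unit_sphere.norm
  have hk := continuousOn_poissonKernel_sphere ha
  set m := Real.circleAverage (fun x => poissonKernel 0 a x * ‖f x‖) 0 1 with hm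
  have h1 : Real.circleAverage (poissonKernel 0 a) 0 1 = 1 := by
    have h := (diffContOnCl_const (c := (1 : ℂ)) (𝕜 := ℂ)
      (s := ball (0 : ℂ) 1)).circleAverage_poissonKernel_smul (w := a) (by simpa using ha)
    have h2 := Complex.ofRealCLM.circleAverage_comp_comm (hk.circleIntegrable zero_le_one)
    have h3 : (Complex.ofRealCLM ∘ poissonKernel 0 a) = poissonKernel 0 a • fun _ => (1 : ℂ) := by
      ext x; simp
    rw [h3, h] at h2
    exact (Complex.ofReal_eq_one.1 h2.symm)
  set N : ℂ → ℝ := fun x => ‖f x‖ with hN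
  set P := poissonKernel 0 a
  have h0 : 0 ≤ Real.circleAverage (P * N ^ 2 - ((2 * m) • (P * N) - m ^ 2 • P)) 0 1 := by
    refine Real.circleAverage_nonneg_of_nonneg fun x hx => ?_
    have hx1 : ‖x‖ = 1 := by simpa using hx
    have := mul_nonneg (poissonKernel_nonneg ha hx1) (sq_nonneg (N x - m))
    simp only [Pi.sub_apply, Pi.mul_apply, Pi.smul_apply, Pi.pow_apply, smul_eq_mul]
    linarith
  have i1 := (hk.mul (hc.pow 2)).circleIntegrable zero_le_one
  have i2 := ((hk.mul hc).const_smul (2 * m)).circleIntegrable zero_le_one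
  have i3 := (hk.const_smul (m ^ 2)).circleIntegrable zero_le_one
  have h2 : Real.circleAverage (P * N) 0 1 = m := rfl
  rw [Real.circleAverage_sub i1 (i2.sub i3), Real.circleAverage_sub i2 i3,
    Real.circleAverage_smul, Real.circleAverage_smul, h1, h2, smul_eq_mul, smul_eq_mul] at h0
  have h3 : Real.circleAverage (P * N ^ 2) 0 1 =
    Real.circleAverage (fun x => P x * ‖f x‖ ^ 2) 0 1 := rfl
  linarith

theorem sq_norm_sub_le_poissonIntegral {f : ℂ → ℂ} (hf : DiffContOnCl ℂ f (ball 0 1))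
    {a b : ℂ} (ha : ‖a‖ < 1) (hb : ‖b‖ < 1) (hab : pseudohyperbolicDist a b ≤ 1 / 2) :
    ‖f a - f b‖ ^ 2 ≤ 144 * pseudohyperbolicDist a b ^ 2 *
      Real.circleAverage (fun x => poissonKernel 0 a x * ‖f x‖ ^ 2) 0 1 := by
  have h1 := norm_sub_le_poissonIntegral hf ha hb hab
  calc _ ≤ (12 * pseudohyperbolicDist a b *
      Real.circleAverage (fun x => poissonKernel 0 a x * ‖f x‖) 0 1) ^ 2 := by gcongr
    _ = 144 * pseudohyperbolicDist a b ^ 2 *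
      Real.circleAverage (fun x => poissonKernel 0 a x * ‖f x‖) 0 1 ^ 2 := by ring
    _ ≤ _ := by gcongr; exact sq_poissonIntegral_le hf ha

/-- The Poisson integral of a continuous function on the circle is the real part of a holomorphic
function. -/
theorem exists_differentiableOn_re_eq_poissonIntegral {g : ℂ → ℝ}
    (hg : ContinuousOn g (sphere 0 1)) :
    ∃ G : ℂ → ℂ, DifferentiableOn ℂ G (ball 0 1) ∧ ∀ w ∈ ball (0 : ℂ) 1,
      (G w).re = Real.circleAverage (fun x => poissonKernel 0 w x * g x) 0 1 := by
  have hgi : CircleIntegrable g 0 1 := hg.circleIntegrable zero_le_one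
  have hgi' : CircleIntegrable (fun ζ => (g ζ : ℂ)) 0 1 :=
    (Complex.continuous_ofReal.comp_continuousOn hg).circleIntegrable zero_le_one
  refine ⟨_, differentiableOn_circleAverage_herglotzRieszKernel_smul hgi', fun w hw => ?_⟩
  rw [re_circleAverage_herglotzRieszKernel_smul hgi hw, poissonKernel_eq_re_herglotzRieszKernel]
  rfl

theorem continuousOn_poissonIntegral {g : ℂ → ℝ} (hg : ContinuousOn g (sphere 0 1)) :
    ContinuousOn (fun w => Real.circleAverage (fun x => poissonKernel 0 w x * g x) 0 1)
      (ball 0 1) := by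
  obtain ⟨G, hG, h⟩ := exists_differentiableOn_re_eq_poissonIntegral hg
  exact (Complex.continuous_re.comp_continuousOn hG.continuousOn).congr fun w hw => (h w hw).symm

theorem poissonIntegral_nonneg {g : ℂ → ℝ} (hg : ∀ x, 0 ≤ g x) {a : ℂ} (ha : ‖a‖ < 1) :
    0 ≤ Real.circleAverage (fun x => poissonKernel 0 a x * g x) 0 1 :=
  Real.circleAverage_nonneg_of_nonneg fun x hx =>
    mul_nonneg (poissonKernel_nonneg ha (by simpa using hx)) (hg x)

/-- The kernel is at most `(1 + |a|)/(1 - |a|) = (1 + |a|)²/(1 - |a|²)`, and `(1 + |a|)² ≤ 4`. -/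
theorem poissonIntegral_le {g : ℂ → ℝ} (hgc : ContinuousOn g (sphere 0 1)) (hg : ∀ x, 0 ≤ g x)
    {a : ℂ} (ha : ‖a‖ < 1) :
    Real.circleAverage (fun x => poissonKernel 0 a x * g x) 0 1 ≤
      4 * (1 - ‖a‖ ^ 2)⁻¹ * Real.circleAverage g 0 1 := by
  rw [← smul_eq_mul, ← Real.circleAverage_smul]
  refine Real.circleAverage_mono
    (((continuousOn_poissonKernel_sphere ha).mul hgc).circleIntegrable zero_le_one)
    ((hgc.const_smul _).circleIntegrable zero_le_one) fun x hx => ?_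
  rw [abs_one] at hx
  rw [Pi.smul_apply, smul_eq_mul]
  refine mul_le_mul_of_nonneg_right ?_ (hg x)
  have h := re_herglotzRieszKernel_le (w := a) hx (by simpa using ha)
  rw [poissonKernel_eq_re_herglotzRieszKernel]
  refine h.trans ?_
  have h0 := norm_nonneg a
  rw [sub_zero, ← div_eq_mul_inv, div_le_div_iff₀ (by linarith) (by nlinarith)]
  nlinarith [mul_nonneg h0 h0, mul_nonneg (mul_nonneg h0 h0) h0, mul_pos (sub_pos.2 ha) (sub_pos.2 ha)]

/-! ### Composition with a self-map: harmonic means and a lower norm bound -/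

theorem DiscSelfMap.norm_apply_zero_lt_one (φ : DiscSelfMap) : ‖φ 0‖ < 1 := by
  simpa using φ.mapsTo (mem_ball_self one_pos)

/-- The Poisson integral is the real part of a holomorphic function, and so is its composition with
`φ`; this is the mean value property. -/
theorem DiscSelfMap.circleAverage_poissonIntegral_comp (φ : DiscSelfMap) {g : ℂ → ℝ}
    (hg : ContinuousOn g (sphere 0 1)) {s : ℝ} (h0 : 0 ≤ s) (h1 : s < 1) :
    Real.circleAverage
      (fun z => Real.circleAverage (fun x => poissonKernel 0 (φ z) x * g x) 0 1) 0 s =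
      Real.circleAverage (fun x => poissonKernel 0 (φ 0) x * g x) 0 1 := by
  obtain ⟨G, hG, h⟩ := exists_differentiableOn_re_eq_poissonIntegral hg
  have hsub : closedBall (0 : ℂ) s ⊆ ball 0 1 := closedBall_subset_ball h1
  have hd : DifferentiableOn ℂ (fun z => G (φ z)) (ball 0 1) := hG.comp φ.differentiableOn φ.mapsTo
  have hcl : DiffContOnCl ℂ (fun z => G (φ z)) (ball 0 |s|) := by
    rw [abs_of_nonneg h0]
    exact ⟨hd.mono (ball_subset_closedBall.trans hsub),
      (hd.continuousOn.mono hsub).mono closure_ball_subset_closedBall⟩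
  have hc : ContinuousOn (fun z => G (φ z)) (sphere 0 s) :=
    hd.continuousOn.mono (sphere_subset_closedBall.trans hsub)
  have h2 := Complex.reCLM.circleAverage_comp_comm (hc.circleIntegrable h0)
  rw [hcl.circleAverage] at h2
  rw [← h _ (φ.mapsTo (mem_ball_self one_pos))]
  refine Eq.trans (Real.circleAverage_congr_sphere fun z hz => ?_) h2
  rw [abs_of_nonneg h0] at hz
  exact (h _ (φ.mapsTo (hsub (sphere_subset_closedBall hz)))).symm

/-- For the kernel `k` at `φ(0)`, `(C_φ k)(0) = k(φ(0)) = ‖k‖²`, while evaluation at `0` has norm at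
most one. So `‖k‖ ≤ ‖C_φ‖`. -/
theorem DiscSelfMap.inv_one_sub_norm_sq_le (φ : DiscSelfMap) :
    (1 - ‖φ 0‖ ^ 2)⁻¹ ≤ ‖φ.compositionOperator‖ ^ 2 := by
  have ha := φ.norm_apply_zero_lt_one
  set k := HardySpace.kernel (φ 0) ha with hk
  have h1 : (φ.compositionOperator k).eval 0 = ((1 - ‖φ 0‖ ^ 2)⁻¹ : ℝ) := by
    rw [φ.eval_compositionOperator _ (mem_ball_self one_pos), hk, HardySpace.eval_kernel_self]
  have h2 : ‖(φ.compositionOperator k).eval 0‖ ≤ ‖φ.compositionOperator‖ * ‖k‖ := by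
    rw [HardySpace.eval_zero]
    exact (lp.norm_apply_le_norm (by norm_num) _ 0).trans (φ.compositionOperator.le_opNorm k)
  have h3 : ‖k‖ ^ 2 = (1 - ‖φ 0‖ ^ 2)⁻¹ := HardySpace.norm_sq_kernel ha
  have h4 : (0 : ℝ) < (1 - ‖φ 0‖ ^ 2)⁻¹ := inv_pos.2 (by nlinarith [norm_nonneg (φ 0)])
  rw [h1, Complex.norm_real, Real.norm_of_nonneg h4.le, ← h3] at h2
  rw [← h3] at h4 ⊢
  have h5 : 0 < ‖k‖ := by
    rcases (norm_nonneg k).eq_or_lt with h | h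
    · rw [← h] at h4; simp at h4
    · exact h
  have : ‖k‖ ≤ ‖φ.compositionOperator‖ := by nlinarith
  gcongr

/-! ### Passage to the boundary -/

theorem HardySpace.tendsto_circleAverage (f : HardySpace) :
    Tendsto (fun s => Real.circleAverage (fun z => ‖f.eval z‖ ^ 2) 0 s) (𝓝[<] 1)
      (𝓝 (‖f‖ ^ 2)) := by
  rw [tendsto_order]
  have hmem := Ioo_mem_nhdsLT (show (0 : ℝ) < 1 by norm_num)
  refine ⟨fun a ha => ?_, fun b hb => ?_⟩
  · obtain ⟨N, hN⟩ := ((f.norm_sq_hasSum.eventually_const_lt ha)).exists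
    have hc : Tendsto (fun s : ℝ => ∑ n ∈ N, ‖f n‖ ^ 2 * s ^ (2 * n)) (𝓝[<] 1)
        (𝓝 (∑ n ∈ N, ‖f n‖ ^ 2 * 1 ^ (2 * n))) :=
      (Continuous.tendsto (by fun_prop) 1).mono_left nhdsWithin_le_nhds
    simp only [one_pow, mul_one] at hc
    filter_upwards [hc.eventually_const_lt hN, hmem] with s hs hs1
    exact hs.trans_le (sum_le_hasSum N (fun n _ => by have := hs1.1; positivity)
      (circleAverage_normSq_hasSum hs1.1.le (f.summable_norm hs1.1.le hs1.2)))
  · filter_upwards [hmem] with s hs1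
    exact (f.circleAverage_le hs1.1.le hs1.2).trans_lt hb

theorem HardySpace.circleAverage_one_le (f : HardySpace) {F : ℂ → ℂ}
    (hF : ContinuousOn F (closedBall 0 1)) (h : Set.EqOn f.eval F (ball 0 1)) :
    Real.circleAverage (fun z => ‖F z‖ ^ 2) 0 1 ≤ ‖f‖ ^ 2 := by
  have hc : ContinuousOn (Real.circleAverage (fun z => ‖F z‖ ^ 2) 0) (Set.Icc 0 1) := by
    refine Real.ContinuousOn.circleAverage ((hF.norm.pow 2).mono fun z hz => ?_) fun r hr => hr.1
    simpa using hz.2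
  have hmem : Set.Ioo (0 : ℝ) 1 ∈ 𝓝[<] 1 := Ioo_mem_nhdsLT (by norm_num)
  have hle : 𝓝[<] (1 : ℝ) ≤ 𝓝[Set.Icc 0 1] 1 :=
    nhdsWithin_le_of_mem (mem_of_superset hmem Set.Ioo_subset_Icc_self)
  refine le_of_tendsto ((hc 1 (by simp)).tendsto.mono_left hle) ?_
  filter_upwards [hmem] with s hs
  refine le_trans (le_of_eq ?_) (f.circleAverage_le hs.1.le hs.2)
  refine Real.circleAverage_congr_sphere fun z hz => ?_
  have hz' : ‖z‖ = s := by simpa [abs_of_pos hs.1] using hz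
  simp only [h (show z ∈ ball (0 : ℂ) 1 by simpa [hz'] using hs.2)]

/-- A sequence of radii increasing to `1`. -/
noncomputable def innerRadius (n : ℕ) : ℝ := 1 - 1 / ((n : ℝ) + 2)

theorem innerRadius_mem (n : ℕ) : innerRadius n ∈ Set.Ico (0 : ℝ) 1 := by
  have h : (0 : ℝ) < (n : ℝ) + 2 := by positivity
  have h1 : 1 / ((n : ℝ) + 2) ≤ 1 := by rw [div_le_one h]; linarith
  have h2 : 0 < 1 / ((n : ℝ) + 2) := by positivity
  exact ⟨by unfold innerRadius; linarith, by unfold innerRadius; linarith⟩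

theorem tendsto_innerRadius : Tendsto innerRadius atTop (𝓝[<] 1) := by
  refine tendsto_nhdsWithin_iff.2 ⟨?_, Eventually.of_forall fun n => (innerRadius_mem n).2⟩
  have h : Tendsto (fun n : ℕ => 1 / (((n + 1 : ℕ) : ℝ) + 1)) atTop (𝓝 0) :=
    tendsto_one_div_add_atTop_nhds_zero_nat.comp (tendsto_add_atTop_nat 1)
  have h2 := h.const_sub 1
  rw [sub_zero] at h2
  refine h2.congr fun n => ?_
  unfold innerRadius
  push_cast
  ring_nf

theorem innerRadius_mul_exp_mem (n : ℕ) (θ : ℝ) :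
    (innerRadius n : ℂ) * Complex.exp (θ * Complex.I) ∈ ball (0 : ℂ) 1 := by
  have h := innerRadius_mem n
  simp [Complex.norm_exp_ofReal_mul_I, abs_of_nonneg h.1, h.2]

theorem continuous_comp_innerRadius {u : ℂ → ℝ} (hu : ContinuousOn u (ball 0 1)) (n : ℕ) :
    Continuous fun θ : ℝ => u (innerRadius n * Complex.exp (θ * Complex.I)) :=
  hu.comp_continuous (by fun_prop) (innerRadius_mul_exp_mem n)

theorem lintegral_circle_innerRadius {u : ℂ → ℝ} (hu : ContinuousOn u (ball 0 1))
    (h0 : ∀ z ∈ ball (0 : ℂ) 1, 0 ≤ u z) (n : ℕ) :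
    ∫⁻ θ in Set.Ioc 0 (2 * Real.pi),
      ENNReal.ofReal (u (innerRadius n * Complex.exp (θ * Complex.I))) =
      ENNReal.ofReal (2 * Real.pi * Real.circleAverage u 0 (innerRadius n)) := by
  have hc := continuous_comp_innerRadius hu n
  rw [← ofReal_integral_eq_lintegral_ofReal (hc.integrableOn_Ioc)
    (Eventually.of_forall fun θ => h0 _ (innerRadius_mul_exp_mem n θ)),
    ← intervalIntegral.integral_of_le Real.two_pi_pos.le, Real.circleAverage_def, smul_eq_mul,
    mul_inv_cancel_left₀ Real.two_pi_pos.ne']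
  simp only [circleMap_zero]

theorem DiscSelfMap.lintegral_liminf_comp_le (φ : DiscSelfMap) {k : ℂ → ℝ} {M : ℝ}
    (hk : ContinuousOn k (ball 0 1)) (h0 : ∀ z ∈ ball (0 : ℂ) 1, 0 ≤ k z)
    (hM : ∀ s : ℝ, 0 ≤ s → s < 1 → Real.circleAverage (fun z => k (φ z)) 0 s ≤ M) :
    ∫⁻ θ in Set.Ioc 0 (2 * Real.pi), liminf (fun n =>
      ENNReal.ofReal (k (φ (innerRadius n * Complex.exp (θ * Complex.I))))) atTop ≤
      ENNReal.ofReal (2 * Real.pi * M) := by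
  have hc : ContinuousOn (fun z => k (φ z)) (ball 0 1) :=
    hk.comp φ.differentiableOn.continuousOn φ.mapsTo
  refine (lintegral_liminf_le fun n =>
    (continuous_comp_innerRadius hc n).measurable.ennreal_ofReal).trans ?_
  refine (liminf_le_limsup).trans (limsup_le_of_le (h := Eventually.of_forall fun n => ?_))
  rw [lintegral_circle_innerRadius hc (fun z hz => h0 _ (φ.mapsTo hz))]
  refine ENNReal.ofReal_le_ofReal ?_
  have := hM _ (innerRadius_mem n).1 (innerRadius_mem n).2
  gcongr

/-- Reverse Fatou lemma along circles increasing to the boundary; the uniform bound supplies the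
integrable majorant. -/
theorem HardySpace.ofReal_norm_sq_le_lintegral_limsup (G : HardySpace) {C : ℝ}
    (hC : ∀ z ∈ ball (0 : ℂ) 1, ‖G.eval z‖ ≤ C) :
    ENNReal.ofReal (2 * Real.pi * ‖G‖ ^ 2) ≤
      ∫⁻ θ in Set.Ioc 0 (2 * Real.pi), limsup (fun n =>
        ENNReal.ofReal (‖G.eval (innerRadius n * Complex.exp (θ * Complex.I))‖ ^ 2)) atTop := by
  have hc : ContinuousOn (fun z => ‖G.eval z‖ ^ 2) (ball 0 1) :=
    G.differentiableOn_eval.continuousOn.norm.pow 2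
  refine le_trans (le_of_eq ?_) (limsup_lintegral_le (fun _ => ENNReal.ofReal (C ^ 2))
    (fun n => (continuous_comp_innerRadius hc n).measurable.ennreal_ofReal)
    (fun n => Eventually.of_forall fun θ => ENNReal.ofReal_le_ofReal ?_) ?_)
  · refine (Tendsto.limsup_eq ?_).symm
    simp only [lintegral_circle_innerRadius hc (fun _ _ => by positivity)]
    exact ENNReal.tendsto_ofReal
      ((G.tendsto_circleAverage.comp tendsto_innerRadius).const_mul _)
  · gcongr
    exact hC _ (innerRadius_mul_exp_mem n θ)
  · simp [ENNReal.mul_eq_top]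

/-- Reverse Fatou on the left and Fatou on the right turn a pointwise boundary inequality into a
norm inequality. The majorants need only be continuous and nonnegative inside the disc with bounded
means after composition. -/
theorem HardySpace.norm_sq_le_of_ae_limsup_le (G : HardySpace) {C : ℝ}
    (hC : ∀ z ∈ ball (0 : ℂ) 1, ‖G.eval z‖ ≤ C) (φ ψ : DiscSelfMap) {k l : ℂ → ℝ} {M N : ℝ}
    (hk : ContinuousOn k (ball 0 1)) (hk0 : ∀ z ∈ ball (0 : ℂ) 1, 0 ≤ k z)
    (hM : ∀ s : ℝ, 0 ≤ s → s < 1 → Real.circleAverage (fun z => k (φ z)) 0 s ≤ M)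
    (hl : ContinuousOn l (ball 0 1)) (hl0 : ∀ z ∈ ball (0 : ℂ) 1, 0 ≤ l z)
    (hN : ∀ s : ℝ, 0 ≤ s → s < 1 → Real.circleAverage (fun z => l (ψ z)) 0 s ≤ N)
    (hM0 : 0 ≤ M) (hN0 : 0 ≤ N)
    (h : ∀ᵐ θ : ℝ, limsup (fun n =>
        ENNReal.ofReal (‖G.eval (innerRadius n * Complex.exp (θ * Complex.I))‖ ^ 2)) atTop ≤
      liminf (fun n =>
        ENNReal.ofReal (k (φ (innerRadius n * Complex.exp (θ * Complex.I))))) atTop +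
      liminf (fun n =>
        ENNReal.ofReal (l (ψ (innerRadius n * Complex.exp (θ * Complex.I))))) atTop) :
    ‖G‖ ^ 2 ≤ M + N := by
  have h1 := (G.ofReal_norm_sq_le_lintegral_limsup hC).trans
    (lintegral_mono_ae (ae_restrict_of_ae h))
  have hc : ContinuousOn (fun z => k (φ z)) (ball 0 1) :=
    hk.comp φ.differentiableOn.continuousOn φ.mapsTo
  rw [lintegral_add_left (.liminf fun n =>
    (continuous_comp_innerRadius hc n).measurable.ennreal_ofReal)] at h1
  have h2 := h1.trans (add_le_add (φ.lintegral_liminf_comp_le hk hk0 hM)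
    (ψ.lintegral_liminf_comp_le hl hl0 hN))
  have hpi := Real.two_pi_pos
  rw [← ENNReal.ofReal_add (by positivity) (by positivity), ← mul_add,
    ENNReal.ofReal_le_ofReal_iff (by positivity)] at h2
  exact le_of_mul_le_mul_left h2 hpi

theorem HardySpace.differentiable_eval_of_finite_support {g : HardySpace} (s : Finset ℕ)
    (h : ∀ n, n ∉ s → g n = 0) : Differentiable ℂ g.eval := by
  have : g.eval = fun z => ∑ n ∈ s, g n * z ^ n := by
    funext z
    exact tsum_eq_sum fun n hn => by simp [h n hn]
  rw [this]
  fun_prop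

/-- Finite Taylor sums are dense and entire. For such `g` the product `B g` is continuous up to the
circle, which the boundary argument uses. -/
theorem HardySpace.opNorm_le_of_differentiable_eval (T : HardySpace →L[ℂ] HardySpace) {M : ℝ}
    (hM : 0 ≤ M) (h : ∀ g : HardySpace, Differentiable ℂ g.eval → ‖T g‖ ≤ M * ‖g‖) :
    ‖T‖ ≤ M := by
  refine T.opNorm_le_bound hM fun g => ?_
  have hs := lp.hasSum_single (p := 2) (by simp) g
  refine le_of_tendsto_of_tendsto ((T.continuous.tendsto g).comp hs).norm (hs.norm.const_mul M)
    (Eventually.of_forall fun s => h _ ?_)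
  refine differentiable_eval_of_finite_support s fun n hn => ?_
  rw [lp.coeFn_sum, Finset.sum_apply]
  refine Finset.sum_eq_zero fun i hi => ?_
  rw [lp.single_apply, Pi.single_eq_of_ne]
  rintro rfl
  exact hn hi

theorem DiscSelfMap.IsBoundaryValue.norm_le_one {φ : DiscSelfMap} {ζ a : ℂ} (hζ : ‖ζ‖ = 1)
    (h : φ.IsBoundaryValue ζ a) : ‖a‖ ≤ 1 := by
  refine le_of_tendsto (h.comp tendsto_innerRadius).norm (Eventually.of_forall fun n => ?_)
  refine (mem_ball_zero_iff.1 (φ.mapsTo ?_)).le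
  have hn := innerRadius_mem n
  simp [hζ, abs_of_nonneg hn.1, hn.2]

theorem diffContOnCl_blaschke_mul {d : ℕ} {a : Fin d → ℂ} (ha : ∀ j, ‖a j‖ < 1) {p : ℂ → ℂ}
    (hp : Differentiable ℂ p) :
    DiffContOnCl ℂ (fun z => (∏ j, (z - a j) / (1 - conj (a j) * z)) * p z) (ball 0 1) := by
  refine DifferentiableOn.diffContOnCl ?_
  rw [closure_ball _ one_ne_zero]
  refine DifferentiableOn.mul (DifferentiableOn.fun_finsetProd fun j _ => ?_) hp.differentiableOn
  refine DifferentiableOn.div (by fun_prop) (by fun_prop) fun z hz h => ?_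
  have h2 : ‖conj (a j) * z‖ < 1 := by
    have hz1 : ‖z‖ ≤ 1 := by simpa using hz
    rw [norm_mul, RCLike.norm_conj]
    nlinarith [norm_nonneg (a j), norm_nonneg z, ha j]
  rw [← sub_eq_zero.1 h] at h2
  simp at h2

theorem DiscSelfMap.circleAverage_comp_le_opNorm (φ : DiscSelfMap) (g : HardySpace) {s : ℝ}
    (h0 : 0 ≤ s) (h1 : s < 1) :
    Real.circleAverage (fun z => ‖g.eval (φ z)‖ ^ 2) 0 s ≤
      ‖φ.compositionOperator‖ ^ 2 * ‖g‖ ^ 2 := by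
  refine le_trans (le_of_eq ?_) (((φ.compositionOperator g).circleAverage_le h0 h1).trans ?_)
  · refine Real.circleAverage_congr_sphere fun z hz => ?_
    have hz' : ‖z‖ = s := by simpa [abs_of_nonneg h0] using hz
    simp only [φ.eval_compositionOperator g (show z ∈ ball (0 : ℂ) 1 by simpa [hz'] using h1)]
  · rw [← mul_pow]
    gcongr
    exact φ.compositionOperator.le_opNorm g

/-! ### The main estimate -/

theorem norm_sq_compositionOperator_sub_le (φ ψ : DiscSelfMap) {d : ℕ} {α : Fin d → ℂ}
    (hα : ∀ j, ‖α j‖ < 1) {S₁ S₂ ε : ℝ} (hε : ε ≤ 1 / 2)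
    (h : ∀ᵐ θ : ℝ, ∀ a b : ℂ, φ.IsBoundaryValue (Complex.exp (θ * Complex.I)) a →
      ψ.IsBoundaryValue (Complex.exp (θ * Complex.I)) b →
      (‖a‖ < 1 ∧ ‖b‖ < 1 ∧ ‖∏ j, (a - α j) / (1 - conj (α j) * a)‖ ≤ S₁ ∧
        ‖∏ j, (b - α j) / (1 - conj (α j) * b)‖ ≤ S₂) ∨ pseudohyperbolicDist a b ≤ ε)
    {g F : HardySpace} (hg : Differentiable ℂ g.eval) (hF : ‖F‖ = ‖g‖)
    (hFe : ∀ z : ℂ, ‖z‖ < 1 →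
      F.eval z = (∏ j, (z - α j) / (1 - conj (α j) * z)) * g.eval z) :
    ‖(φ.compositionOperator - ψ.compositionOperator) F‖ ^ 2 ≤
      (2 * S₁ ^ 2 * ‖φ.compositionOperator‖ ^ 2 + 2 * S₂ ^ 2 * ‖ψ.compositionOperator‖ ^ 2 +
        576 * ε ^ 2 * ‖φ.compositionOperator‖ ^ 2) * ‖g‖ ^ 2 := by
  set f : ℂ → ℂ := fun z => (∏ j, (z - α j) / (1 - conj (α j) * z)) * g.eval z with hf
  have hfd : DiffContOnCl ℂ f (ball 0 1) := diffContOnCl_blaschke_mul hα hg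
  have hfc : ContinuousOn f (closedBall 0 1) :=
    closure_ball (0 : ℂ) one_ne_zero ▸ hfd.continuousOn
  have hfs : ContinuousOn (fun x => ‖f x‖ ^ 2) (sphere 0 1) :=
    (hfc.mono sphere_subset_closedBall).norm.pow 2
  have hFf : Set.EqOn F.eval f (ball 0 1) := fun z hz => hFe z (by simpa using hz)
  set v : ℂ → ℝ := fun w => Real.circleAverage (fun x => poissonKernel 0 w x * ‖f x‖ ^ 2) 0 1
    with hv
  have hvc : ContinuousOn v (ball 0 1) := continuousOn_poissonIntegral hfs
  have hv0 : ∀ z ∈ ball (0 : ℂ) 1, 0 ≤ v z := fun z hz =>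
    poissonIntegral_nonneg (fun _ => by positivity) (by simpa using hz)
  have hvφ : v (φ 0) ≤ 4 * ‖φ.compositionOperator‖ ^ 2 * ‖g‖ ^ 2 := by
    refine (poissonIntegral_le hfs (fun _ => by positivity) φ.norm_apply_zero_lt_one).trans ?_
    have h1 := F.circleAverage_one_le hfc hFf
    rw [hF] at h1
    have h2 := φ.inv_one_sub_norm_sq_le
    have h3 : 0 ≤ Real.circleAverage (fun x => ‖f x‖ ^ 2) 0 1 :=
      Real.circleAverage_nonneg_of_nonneg fun _ _ => by positivity
    gcongr
  obtain ⟨C, hC⟩ := (isCompact_closedBall (0 : ℂ) 1).exists_bound_of_continuousOn hfc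
  set G := (φ.compositionOperator - ψ.compositionOperator) F with hG
  have hGe : ∀ z ∈ ball (0 : ℂ) 1, G.eval z = f (φ z) - f (ψ z) := by
    intro z hz
    rw [hG, sub_apply, HardySpace.eval_sub _ _ (by simpa using hz),
      φ.eval_compositionOperator _ hz, ψ.eval_compositionOperator _ hz, hFf (φ.mapsTo hz),
      hFf (ψ.mapsTo hz)]
  have hGC : ∀ z ∈ ball (0 : ℂ) 1, ‖G.eval z‖ ≤ C + C := by
    intro z hz
    rw [hGe z hz]
    exact (norm_sub_le _ _).trans (add_le_add (hC _ (ball_subset_closedBall (φ.mapsTo hz)))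
      (hC _ (ball_subset_closedBall (ψ.mapsTo hz))))
  have hgc : Continuous fun z => ‖g.eval z‖ ^ 2 := hg.continuous.norm.pow 2
  -- The majorants: the terms in `g` serve where the Blaschke product is small at both values, the
  -- Poisson term where the values are close. Since the mean of `v ∘ φ` is at most `4 ‖C_φ‖² ‖g‖²`,
  -- the constant `576 = 144 · 4` results.
  set k : ℂ → ℝ := fun z => 2 * S₁ ^ 2 * ‖g.eval z‖ ^ 2 + 144 * ε ^ 2 * v z with hk
  set l : ℂ → ℝ := fun z => 2 * S₂ ^ 2 * ‖g.eval z‖ ^ 2 with hl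
  have hkc : ContinuousOn k (ball 0 1) :=
    (hgc.continuousOn.const_mul _).add (hvc.const_mul _)
  have hlc : ContinuousOn l (ball 0 1) := hgc.continuousOn.const_mul _
  have hk0 : ∀ z ∈ ball (0 : ℂ) 1, 0 ≤ k z := fun z hz => by
    have := hv0 z hz
    positivity
  have hl0 : ∀ z ∈ ball (0 : ℂ) 1, 0 ≤ l z := fun z hz => by positivity
  have hM : ∀ s : ℝ, 0 ≤ s → s < 1 → Real.circleAverage (fun z => k (φ z)) 0 s ≤
      2 * S₁ ^ 2 * (‖φ.compositionOperator‖ ^ 2 * ‖g‖ ^ 2) +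
        144 * ε ^ 2 * (4 * ‖φ.compositionOperator‖ ^ 2 * ‖g‖ ^ 2) := by
    intro s h0 h1
    have hsub : sphere (0 : ℂ) s ⊆ ball 0 1 :=
      sphere_subset_closedBall.trans (closedBall_subset_ball h1)
    have hφc : ContinuousOn φ (sphere 0 s) := φ.differentiableOn.continuousOn.mono hsub
    have i1 : CircleIntegrable (fun z => ‖g.eval (φ z)‖ ^ 2) 0 s :=
      (hgc.comp_continuousOn hφc).circleIntegrable h0
    have i2 : CircleIntegrable (fun z => v (φ z)) 0 s :=
      (hvc.comp hφc (φ.mapsTo.mono_left hsub)).circleIntegrable h0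
    have e := Real.circleAverage_add (i1.const_smul (a := 2 * S₁ ^ 2))
      (i2.const_smul (a := 144 * ε ^ 2))
    rw [Real.circleAverage_smul, Real.circleAverage_smul, smul_eq_mul, smul_eq_mul,
      φ.circleAverage_poissonIntegral_comp hfs h0 h1] at e
    refine (le_of_eq e).trans ?_
    have := φ.circleAverage_comp_le_opNorm g h0 h1
    gcongr
  have hN : ∀ s : ℝ, 0 ≤ s → s < 1 → Real.circleAverage (fun z => l (ψ z)) 0 s ≤
      2 * S₂ ^ 2 * (‖ψ.compositionOperator‖ ^ 2 * ‖g‖ ^ 2) := by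
    intro s h0 h1
    have e := Real.circleAverage_fun_smul (a := 2 * S₂ ^ 2)
      (f := fun z => ‖g.eval (ψ z)‖ ^ 2) (c := 0) (R := s)
    refine (le_of_eq e).trans ?_
    have := ψ.circleAverage_comp_le_opNorm g h0 h1
    rw [smul_eq_mul]
    gcongr
  refine (G.norm_sq_le_of_ae_limsup_le hGC φ ψ hkc hk0 hM hlc hl0 hN (by positivity)
    (by positivity) ?_).trans (le_of_eq (by ring))
  filter_upwards [h, φ.ae_exists_isBoundaryValue, ψ.ae_exists_isBoundaryValue]
    with θ hθ ⟨a, ha⟩ ⟨b, hb⟩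
  have ha1 := ha.norm_le_one (Complex.norm_exp_ofReal_mul_I θ)
  have hb1 := hb.norm_le_one (Complex.norm_exp_ofReal_mul_I θ)
  have hta := ha.comp tendsto_innerRadius
  have htb := hb.comp tendsto_innerRadius
  have hlim : ∀ (χ : DiscSelfMap) (c : ℂ), ‖c‖ ≤ 1 →
      Tendsto (fun n => χ (innerRadius n * Complex.exp (θ * Complex.I))) atTop (𝓝 c) →
      Tendsto (fun n => f (χ (innerRadius n * Complex.exp (θ * Complex.I)))) atTop
        (𝓝 (f c)) := by
    intro χ c hc ht
    refine (hfc c (by simpa using hc)).tendsto.comp (tendsto_nhdsWithin_iff.2 ⟨ht,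
      Eventually.of_forall fun n => ball_subset_closedBall (χ.mapsTo ?_)⟩)
    exact innerRadius_mul_exp_mem n θ
  have hsup : limsup (fun n =>
      ENNReal.ofReal (‖G.eval (innerRadius n * Complex.exp (θ * Complex.I))‖ ^ 2)) atTop =
      ENNReal.ofReal (‖f a - f b‖ ^ 2) := by
    refine Tendsto.limsup_eq (ENNReal.tendsto_ofReal ?_)
    simp only [hGe _ (innerRadius_mul_exp_mem _ θ)]
    exact ((hlim φ a ha1 hta).sub (hlim ψ b hb1 htb)).norm.pow 2
  rw [hsup]
  have hinf : ∀ (χ : DiscSelfMap) (c : ℂ) (u : ℂ → ℝ), ContinuousOn u (ball 0 1) → ‖c‖ < 1 →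
      Tendsto (fun n => χ (innerRadius n * Complex.exp (θ * Complex.I))) atTop (𝓝 c) →
      liminf (fun n => ENNReal.ofReal
        (u (χ (innerRadius n * Complex.exp (θ * Complex.I))))) atTop =
        ENNReal.ofReal (u c) := by
    intro χ c u hu hc ht
    refine Tendsto.liminf_eq (ENNReal.tendsto_ofReal ?_)
    exact (hu.continuousAt (isOpen_ball.mem_nhds (by simpa using hc))).tendsto.comp ht
  -- Equal values, possibly on the circle where the majorants give nothing, contribute zero. For
  -- distinct values both alternatives place `a` and `b` inside the disc, where `k` and `l` are
  -- continuous.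
  by_cases hab : a = b
  · simp [hab]
  have key : ‖a‖ < 1 ∧ ‖b‖ < 1 ∧ ‖f a - f b‖ ^ 2 ≤ k a + l b := by
    rcases hθ a b ha hb with ⟨ha2, hb2, hBa, hBb⟩ | hρ
    · refine ⟨ha2, hb2, ?_⟩
      have h1 : ‖f a‖ ≤ S₁ * ‖g.eval a‖ := by
        rw [hf, norm_mul]
        gcongr
      have h2 : ‖f b‖ ≤ S₂ * ‖g.eval b‖ := by
        rw [hf, norm_mul]
        gcongr
      have h3 : 0 ≤ 144 * ε ^ 2 * v a := by
        have := hv0 a (by simpa using ha2)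
        positivity
      calc ‖f a - f b‖ ^ 2 ≤ (S₁ * ‖g.eval a‖ + S₂ * ‖g.eval b‖) ^ 2 := by
            gcongr
            exact (norm_sub_le _ _).trans (add_le_add h1 h2)
        _ ≤ k a + l b := by
            simp only [hk, hl]
            nlinarith [sq_nonneg (S₁ * ‖g.eval a‖ - S₂ * ‖g.eval b‖)]
    · have ha2 : ‖a‖ < 1 := by
        refine lt_of_le_of_ne ha1 fun h1 => ?_
        rw [pseudohyperbolicDist_of_norm_eq_one h1 hab] at hρ
        linarith
      have hb2 : ‖b‖ < 1 := by
        refine lt_of_le_of_ne hb1 fun h1 => ?_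
        rw [pseudohyperbolicDist_comm,
          pseudohyperbolicDist_of_norm_eq_one h1 (Ne.symm hab)] at hρ
        linarith
      refine ⟨ha2, hb2, ?_⟩
      refine (sq_norm_sub_le_poissonIntegral hfd ha2 hb2 (hρ.trans hε)).trans ?_
      have h1 : 144 * pseudohyperbolicDist a b ^ 2 * v a ≤ 144 * ε ^ 2 * v a := by
        have := hv0 a (by simpa using ha2)
        have := pseudohyperbolicDist_nonneg a b
        gcongr
      have h2 : 0 ≤ 2 * S₁ ^ 2 * ‖g.eval a‖ ^ 2 := by positivity
      have h3 := hl0 b (by simpa using hb2)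
      simp only [hk]
      linarith
  obtain ⟨ha2, hb2, hle⟩ := key
  rw [hinf φ a k hkc ha2 hta, hinf ψ b l hlc hb2 htb,
    ← ENNReal.ofReal_add (hk0 a (by simpa using ha2)) (hl0 b (by simpa using hb2))]
  exact ENNReal.ofReal_le_ofReal hle

/-- For `ε ≤ 1/2` the main estimate applies, and `24` is the square root of its largest constant
`576`. For `ε > 1/2` the norm of the difference is already small enough, since `24 ε > 1`. -/
theorem approximationNumber_compositionOperator_sub_le (φ ψ : DiscSelfMap) {n : ℕ} (hn : 1 ≤ n)
    {B : ℂ → ℂ} (hB : IsBlaschkeProduct (n - 1) B) {S₁ S₂ ε : ℝ} (hS₁ : 0 ≤ S₁) (hS₂ : 0 ≤ S₂)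
    (hε : 0 ≤ ε)
    (h : ∀ᵐ θ : ℝ, ∀ a b : ℂ, φ.IsBoundaryValue (Complex.exp (θ * Complex.I)) a →
      ψ.IsBoundaryValue (Complex.exp (θ * Complex.I)) b →
      (‖a‖ < 1 ∧ ‖b‖ < 1 ∧ ‖B a‖ ≤ S₁ ∧ ‖B b‖ ≤ S₂) ∨ pseudohyperbolicDist a b ≤ ε) :
    approximationNumber n (φ.compositionOperator - ψ.compositionOperator) ≤
      24 * (S₁ + S₂ + ε) * (‖φ.compositionOperator‖ + ‖ψ.compositionOperator‖) := by
  set X := ‖φ.compositionOperator‖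
  set Y := ‖ψ.compositionOperator‖
  have hX : 0 ≤ X := norm_nonneg _
  have hY : 0 ≤ Y := norm_nonneg _
  rcases le_or_gt ε (1 / 2) with hε2 | hε2
  · obtain ⟨c, α, hc, hα, hBe⟩ := hB
    have hBn : ∀ z : ℂ, ‖z‖ < 1 → ‖B z‖ = ‖∏ j, (z - α j) / (1 - conj (α j) * z)‖ := by
      intro z hz
      rw [hBe z (by simpa using hz), norm_mul, hc, one_mul]
    obtain ⟨V, hVn, hVe, hVr⟩ := HardySpace.exists_blaschkeProduct (n - 1) α hα
    refine (approximationNumber_le_norm_comp _ V hVn (hVr.trans_lt ?_)).trans ?_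
    · exact_mod_cast Nat.sub_lt hn one_pos
    refine HardySpace.opNorm_le_of_differentiable_eval _ (by positivity) fun g hg => ?_
    rw [ContinuousLinearMap.comp_apply]
    refine le_of_sq_le_sq ?_ (by positivity)
    refine (norm_sq_compositionOperator_sub_le φ ψ hα hε2 (S₁ := S₁) (S₂ := S₂) ?_ hg (hVn g)
      (hVe g)).trans ?_
    · filter_upwards [h] with θ hθ a b ha hb
      refine (hθ a b ha hb).imp_left fun ⟨h1, h2, h3, h4⟩ => ⟨h1, h2, ?_, ?_⟩
      · rwa [← hBn a h1]
      · rwa [← hBn b h2]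
    · rw [mul_pow]
      gcongr
      have h1 : X ^ 2 ≤ (X + Y) ^ 2 := by gcongr; linarith
      have h2 : Y ^ 2 ≤ (X + Y) ^ 2 := by gcongr; linarith
      calc 2 * S₁ ^ 2 * X ^ 2 + 2 * S₂ ^ 2 * Y ^ 2 + 576 * ε ^ 2 * X ^ 2
          ≤ 2 * S₁ ^ 2 * (X + Y) ^ 2 + 2 * S₂ ^ 2 * (X + Y) ^ 2 +
            576 * ε ^ 2 * (X + Y) ^ 2 := by gcongr
        _ = (2 * S₁ ^ 2 + 2 * S₂ ^ 2 + 576 * ε ^ 2) * (X + Y) ^ 2 := by ring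
        _ ≤ (576 * (S₁ + S₂ + ε) ^ 2) * (X + Y) ^ 2 := by
          gcongr
          nlinarith [mul_nonneg hS₁ hS₂, mul_nonneg hS₁ hε, mul_nonneg hS₂ hε,
            sq_nonneg S₁, sq_nonneg S₂]
        _ = (24 * (S₁ + S₂ + ε) * (X + Y)) ^ 2 := by ring
  · refine (approximationNumber_le_norm hn _).trans ((norm_sub_le _ _).trans ?_)
    refine le_mul_of_one_le_left (by positivity) ?_
    linarith

/-! ### From almost everywhere bounds to the suprema -/

theorem supDist_nonneg (φ ψ : DiscSelfMap) (P : ℂ → ℂ → Prop) : 0 ≤ supDist φ ψ P :=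
  Real.sSup_nonneg (by
    rintro _ ⟨_, a, b, -, -, -, -, rfl⟩
    exact pseudohyperbolicDist_nonneg a b)

theorem le_supDist {φ ψ : DiscSelfMap} {P : ℂ → ℂ → Prop} {ζ a b : ℂ} (hζ : ‖ζ‖ = 1)
    (ha : φ.IsBoundaryValue ζ a) (hb : ψ.IsBoundaryValue ζ b) (h : P a b) :
    pseudohyperbolicDist a b ≤ supDist φ ψ P := by
  refine le_csSup ⟨1, ?_⟩ ⟨ζ, a, b, hζ, ha, hb, h, rfl⟩
  rintro _ ⟨ζ, a, b, hζ, ha, hb, -, rfl⟩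
  exact pseudohyperbolicDist_le_one (ha.norm_le_one hζ) (hb.norm_le_one hζ)

theorem supBlaschke_nonneg (B : ℂ → ℂ) (φ : DiscSelfMap) (A : Set ℂ) : 0 ≤ supBlaschke B φ A :=
  Real.sSup_nonneg (by
    rintro _ ⟨_, a, -, -, -, rfl⟩
    exact norm_nonneg _)

/-- Each factor has modulus the pseudohyperbolic distance from `z` to a zero. This bounds the set in
`supBlaschke`, without which its supremum would default to `0`. -/
theorem IsBlaschkeProduct.norm_le_one {d : ℕ} {B : ℂ → ℂ} (hB : IsBlaschkeProduct d B) {z : ℂ}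
    (hz : ‖z‖ < 1) : ‖B z‖ ≤ 1 := by
  obtain ⟨c, α, hc, hα, h⟩ := hB
  rw [h z (by simpa using hz), norm_mul, hc, one_mul, norm_prod]
  refine Finset.prod_le_one (fun _ _ => norm_nonneg _) fun j _ => ?_
  have := pseudohyperbolicDist_le_one (hα j).le hz.le
  rwa [pseudohyperbolicDist, norm_sub_rev, ← norm_div] at this

theorem le_supBlaschke {d : ℕ} {B : ℂ → ℂ} (hB : IsBlaschkeProduct d B) {φ : DiscSelfMap}
    {A : Set ℂ} (hA : ∀ a ∈ A, ‖a‖ < 1) {ζ a : ℂ} (hζ : ‖ζ‖ = 1) (ha : φ.IsBoundaryValue ζ a)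
    (h : a ∈ A) : ‖B a‖ ≤ supBlaschke B φ A := by
  refine le_csSup ⟨1, ?_⟩ ⟨ζ, a, hζ, ha, h, rfl⟩
  rintro _ ⟨ζ, a, -, -, h, rfl⟩
  exact hB.norm_le_one (hA a h)

/-- The set `A` lets the closed and the open disc of radius `r` be treated together. Here `ε` is the
sum of the two distance suprema, as either one alone may be the relevant bound. -/
theorem approximationNumber_compositionOperator_sub_le_sup (φ ψ : DiscSelfMap) {n : ℕ}
    (hn : 1 ≤ n) {B : ℂ → ℂ} (hB : IsBlaschkeProduct (n - 1) B) (r : ℝ) {A : Set ℂ}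
    (hA : ∀ a ∈ A, ‖a‖ < 1)
    (h : ∀ᵐ θ : ℝ, ∀ a b : ℂ, φ.IsBoundaryValue (Complex.exp (θ * Complex.I)) a →
      ψ.IsBoundaryValue (Complex.exp (θ * Complex.I)) b →
      (a ∈ A ∧ b ∈ A) ∨ r < ‖a‖ ∨ r < ‖b‖) :
    approximationNumber n (φ.compositionOperator - ψ.compositionOperator) ≤
      24 * (supBlaschke B φ A + supBlaschke B ψ A +
        supDist φ ψ (fun a _ => r < ‖a‖) + supDist φ ψ (fun _ b => r < ‖b‖)) *
        (‖φ.compositionOperator‖ + ‖ψ.compositionOperator‖) := by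
  have h3 := supDist_nonneg φ ψ fun a _ => r < ‖a‖
  have h4 := supDist_nonneg φ ψ fun _ b => r < ‖b‖
  rw [add_assoc (supBlaschke B φ A + supBlaschke B ψ A)]
  refine approximationNumber_compositionOperator_sub_le φ ψ hn hB (supBlaschke_nonneg B φ A)
    (supBlaschke_nonneg B ψ A) (add_nonneg h3 h4) ?_
  filter_upwards [h] with θ hθ a b ha hb
  have hζ := Complex.norm_exp_ofReal_mul_I θ
  rcases hθ a b ha hb with ⟨haA, hbA⟩ | h1 | h1
  · exact Or.inl ⟨hA a haA, hA b hbA, le_supBlaschke hB hA hζ ha haA,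
      le_supBlaschke hB hA hζ hb hbA⟩
  · exact Or.inr ((le_supDist (P := fun a _ => r < ‖a‖) hζ ha hb h1).trans
      (le_add_of_nonneg_right h4))
  · exact Or.inr ((le_supDist (P := fun _ b => r < ‖b‖) hζ ha hb h1).trans
      (le_add_of_nonneg_left h3))

theorem mainTheorem8 :
    ∃ C : ℝ, 0 < C ∧ ∀ (r : ℝ), 0 < r → r < 1 → ∀ (n : ℕ), 1 ≤ n →
      ∀ (B : ℂ → ℂ), IsBlaschkeProduct (n - 1) B → ∀ (φ ψ : DiscSelfMap),
        approximationNumber n (φ.compositionOperator - ψ.compositionOperator) ≤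
            C * (supBlaschke B φ {a | ‖a‖ ≤ r} + supBlaschke B ψ {a | ‖a‖ ≤ r} +
              supDist φ ψ (fun a _ => r < ‖a‖) + supDist φ ψ (fun _ b => r < ‖b‖)) *
              (‖φ.compositionOperator‖ + ‖ψ.compositionOperator‖) ∧
        ((∀ᵐ θ : ℝ, ∀ a b : ℂ, φ.IsBoundaryValue (Complex.exp (θ * Complex.I)) a →
            ψ.IsBoundaryValue (Complex.exp (θ * Complex.I)) b → max ‖a‖ ‖b‖ ≠ r) →
          approximationNumber n (φ.compositionOperator - ψ.compositionOperator) ≤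
            C * (supBlaschke B φ {a | ‖a‖ < r} + supBlaschke B ψ {a | ‖a‖ < r} +
              supDist φ ψ (fun a _ => r < ‖a‖) + supDist φ ψ (fun _ b => r < ‖b‖)) *
              (‖φ.compositionOperator‖ + ‖ψ.compositionOperator‖)) := by
  
  refine ⟨24, by norm_num, fun r _ hr1 n hn B hB φ ψ => ⟨?_, fun h => ?_⟩⟩
  · refine approximationNumber_compositionOperator_sub_le_sup φ ψ hn hB r
      (fun a ha => lt_of_le_of_lt ha hr1) (Eventually.of_forall fun θ a b _ _ => ?_)
    by_cases h1 : r < ‖a‖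
    · exact Or.inr (Or.inl h1)
    by_cases h2 : r < ‖b‖
    · exact Or.inr (Or.inr h2)
    exact Or.inl ⟨not_lt.1 h1, not_lt.1 h2⟩
  · refine approximationNumber_compositionOperator_sub_le_sup φ ψ hn hB r
      (fun a ha => lt_trans ha hr1) ?_
    -- Off the null set where the larger modulus equals `r`, either both values lie in the open disc
    -- or one has modulus above `r`.
    filter_upwards [h] with θ hθ a b ha hb
    rcases (hθ a b ha hb).lt_or_gt with h1 | h1
    · exact Or.inl (max_lt_iff.1 h1)
    · exact Or.inr (lt_max_iff.1 h1)
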